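/- Let $(M^n,g)$ be a connected Riemannian spin manifold without boundary (with $g$ at least $C^1$), with a fixed spin structure, let $k$ be a symmetric $2$-tensor on $M$, and let $\nabla$ be the Levi-Civita connection. Let $\mathcal S$ be the complex spinor bundle (the bundle associated with an irreducible complex module of the Clifford algebra with $e_ie_j+e_je_i=-2\delta_{ij}$, with a Hermitian product $\langle\cdot,\cdot\rangle$, linear in the first slot, for which vectors act skew-adjointly), with the induced connection, and let $\overline{\mathcal S}=\mathcal S\oplus\mathcal S$ be the spacetime spinor bundle with the direct sum product and connection and the Clifford multiplication $$e_i(\psi_1,\psi_2)=(e_i\psi_1,-e_i\psi_2)\quad(1\le i\le n),\qquad e_0(\psi_1,\psi_2)=(\psi_2,\psi_1).$$ For a section $\psi$ of $\overline{\mathcal S}$ and a local orthonormal frame $e_1,\dots,e_n$ put $$N=|\psi|^2,\quad X=\sum_i\langle e_ie_0\psi,\psi\rangle e_i,\quad Y=\sum_i\langle \mathbf i e_i\psi,\psi\rangle e_i,\quad \omega_{ij}=\operatorname{Im}\langle e_ie_je_0\psi,\psi\rangle .$$ These define a real function, two real vector fields and a two-form on $M$, independently of the frame. **Theorem.** Let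 $\psi$ be a $C^1$ section of $\overline{\mathcal S}$ such that (with summation over repeated indices) $$\nabla_i\psi=-\tfrac12k_{ij}e_je_0\psi-\tfrac12\mathbf i e_i\psi .$$ Then $N,X,Y,\omega$ are differentiable and $$\begin{aligned} \nabla_iN&=-k_{ij}X_j-Y_i,\\ \nabla_iX_j&=-k_{ij}N+\omega_{ij},\\ \nabla_iY_j&=-g_{ij}N+k_{il}\omega_{jl},\\ \nabla_i\omega_{jk}&=g_{ij}X_k-g_{ik}X_j-k_{ij}Y_k+k_{ik}Y_j . \end{aligned}$$ Moreover the function $$N^2-|X|^2-|Y|^2+\tfrac12|\omega|^2,\qquad |\omega|^2=\sum_{i,j}\omega_{ij}^2,$$ is constant on $M$. -/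

import Mathlib

open Bundle Manifold
open scoped ContDiff

noncomputable section

namespace KillingBilinears

/-! ### Clifford algebra and spinor modules -/

/-- The quadratic form `v ↦ -|v|²` on `ℝⁿ`; its Clifford algebra has `v · v = -|v|²`. -/
def negForm (n : ℕ) : QuadraticForm ℝ (EuclideanSpace ℝ (Fin n)) :=
  LinearMap.BilinMap.toQuadraticMap (-innerₗ (EuclideanSpace ℝ (Fin n)))

/-- The real Clifford algebra of `ℝⁿ` with relations `e_i e_j + e_j e_i = -2 δ_ij`. -/
abbrev Cl (n : ℕ) : Type := CliffordAlgebra (negForm n)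

/-- The standard basis vector `e_i` of `ℝⁿ`, as an element of the Clifford algebra. -/
def gen {n : ℕ} (i : Fin n) : Cl n :=
  CliffordAlgebra.ι (negForm n) (EuclideanSpace.single i 1)

variable {n : ℕ} {Δ : Type*} [NormedAddCommGroup Δ] [InnerProductSpace ℂ Δ]

/-- A complex spinor module for `ℝⁿ`: an irreducible complex representation of the Clifford
algebra, with a Hermitian inner product for which Clifford multiplication by vectors is
skew-adjoint. -/
structure SpinorModule (n : ℕ) (Δ : Type*) [NormedAddCommGroup Δ] [InnerProductSpace ℂ Δ] where
  /-- Clifford multiplication -/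
  act : Cl n →ₐ[ℝ] Module.End ℂ Δ
  skew : ∀ (v : EuclideanSpace ℝ (Fin n)) (φ χ : Δ),
    inner ℂ (act (CliffordAlgebra.ι (negForm n) v) φ) χ =
      -inner ℂ φ (act (CliffordAlgebra.ι (negForm n) v) χ)
  nontrivial : Nontrivial Δ
  irreducible : ∀ p : Submodule ℂ Δ, (∀ a : Cl n, ∀ φ ∈ p, act a φ ∈ p) → p = ⊥ ∨ p = ⊤

/-- The fibre `Δ ⊕ Δ` of the spacetime spinor bundle, with the direct sum Hermitian product. -/
abbrev Spacetime (Δ : Type*) : Type _ := WithLp 2 (Δ × Δ)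

/-- Clifford multiplication by `e_0`: `e_0 (ψ₁, ψ₂) = (ψ₂, ψ₁)`. -/
def cl0 (φ : Spacetime Δ) : Spacetime Δ := WithLp.toLp 2 (φ.snd, φ.fst)

/-- Clifford multiplication by `e_i`, `1 ≤ i ≤ n`: `e_i (ψ₁, ψ₂) = (e_i ψ₁, -e_i ψ₂)`. -/
def cl (ρ : SpinorModule n Δ) (i : Fin n) (φ : Spacetime Δ) : Spacetime Δ :=
  WithLp.toLp 2 (ρ.act (gen i) φ.fst, -ρ.act (gen i) φ.snd)

/-- The diagonal action of the Clifford algebra (in particular of the spin group) on `Δ ⊕ Δ`,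
by which the spacetime spinor bundle is associated with the spin structure. -/
def diagAct (ρ : SpinorModule n Δ) (a : Cl n) (φ : Spacetime Δ) : Spacetime Δ :=
  WithLp.toLp 2 (ρ.act a φ.fst, ρ.act a φ.snd)

/-! The bilinears at a point, in an orthonormal frame. The pairing `⟨φ, χ⟩`, linear in `φ`,
is `inner ℂ χ φ` in Mathlib's convention. -/

/-- `X_i = ⟨e_i e_0 φ, φ⟩`; this number is real. -/
def Xcomp (ρ : SpinorModule n Δ) (φ : Spacetime Δ) (i : Fin n) : ℝ :=
  (inner ℂ φ (cl ρ i (cl0 φ))).re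

/-- `Y_i = ⟨𝐢 e_i φ, φ⟩`; this number is real. -/
def Ycomp (ρ : SpinorModule n Δ) (φ : Spacetime Δ) (i : Fin n) : ℝ :=
  (inner ℂ φ (Complex.I • cl ρ i φ)).re

/-- `ω_ij = Im ⟨e_i e_j e_0 φ, φ⟩`. -/
def omegaComp (ρ : SpinorModule n Δ) (φ : Spacetime Δ) (i j : Fin n) : ℝ :=
  (inner ℂ φ (cl ρ i (cl ρ j (cl0 φ)))).im

/-! ### Spin structures, spinor fields and the spinor connection -/

/-- The standard model with corners of `ℝⁿ` (manifolds without boundary). -/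
abbrev model (n : ℕ) := 𝓘(ℝ, EuclideanSpace ℝ (Fin n))

variable {M : Type*} [TopologicalSpace M] [ChartedSpace (EuclideanSpace ℝ (Fin n)) M]
  [IsManifold (model n) ∞ M]
  [RiemannianBundle (fun x : M => TangentSpace (model n) x)]

/-- A spin structure on a Riemannian manifold, given by local orthonormal frames on an open cover
and a cocycle of transition functions with values in `Spin(n)` that lifts the transition matrices
`⟨e^a_i, e^b_j⟩` of the frames along the double cover `Spin(n) → SO(n)`, `g ↦ (v ↦ g v g⁻¹)`. -/
structure SpinStructure (n : ℕ) (M : Type*) [TopologicalSpace M]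
    [ChartedSpace (EuclideanSpace ℝ (Fin n)) M] [IsManifold (model n) ∞ M]
    [RiemannianBundle (fun x : M => TangentSpace (model n) x)] (κ : Type*) where
  /-- the open cover -/
  U : κ → Set M
  isOpen : ∀ a, IsOpen (U a)
  cover : ∀ x, ∃ a, x ∈ U a
  /-- the local orthonormal frames -/
  frame : κ → Fin n → (x : M) → TangentSpace (model n) x
  frame_contMDiffOn : ∀ a i, ContMDiffOn (model n)
    ((model n).prod 𝓘(ℝ, EuclideanSpace ℝ (Fin n))) 1 (T% (frame a i)) (U a)
  frame_orthonormal : ∀ a, ∀ x ∈ U a, Orthonormal ℝ (fun i => frame a i x)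
  /-- the `Spin(n)`-valued transition functions -/
  trans : κ → κ → M → Cl n
  trans_mem : ∀ a b, ∀ x ∈ U a ∩ U b, trans a b x ∈ spinGroup (negForm n)
  trans_contMDiffOn : ∀ a b (l : Cl n →ₗ[ℝ] ℝ),
    ContMDiffOn (model n) 𝓘(ℝ, ℝ) 1 (fun x => l (trans a b x)) (U a ∩ U b)
  trans_cocycle : ∀ a b c, ∀ x ∈ U a ∩ U b ∩ U c,
    trans a b x * trans b c x = trans a c x
  trans_lifts : ∀ a b, ∀ x ∈ U a ∩ U b, ∀ j,
    trans a b x * gen j =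
      (∑ i, (inner ℝ (frame a i x) (frame b j x) : ℝ) • gen i) * trans a b x

variable {κ : Type*}

/-- An index of the cover whose open set contains the given point. -/
def SpinStructure.indexAt (S : SpinStructure n M κ) (x : M) : κ := (S.cover x).choose

/-- A `C¹` section of the spacetime spinor bundle `𝒮 ⊕ 𝒮`, given by its local representatives. -/
structure SpinorField (S : SpinStructure n M κ) (ρ : SpinorModule n Δ) where
  /-- the representative of the section in the frame with the given index -/
  rep : κ → M → Spacetime Δ
  contMDiffOn : ∀ a, ContMDiffOn (model n) 𝓘(ℝ, Spacetime Δ) 1 (rep a) (S.U a)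
  compat : ∀ a b, ∀ x ∈ S.U a ∩ S.U b, rep a x = diagAct ρ (S.trans a b x) (rep b x)

/-- A covariant derivative on the tangent bundle is the Levi-Civita connection if it is metric
and torsion-free. -/
structure IsLeviCivita [IsContMDiffRiemannianBundle (model n) 1 (EuclideanSpace ℝ (Fin n))
      (fun x : M => TangentSpace (model n) x)]
    (D : CovariantDerivative (model n) (EuclideanSpace ℝ (Fin n))
      (fun x : M => TangentSpace (model n) x)) : Prop where
  metric : D.IsMetricCompatible
  torsion : D.torsion = 0

/-- The connection induced by `D` on the spacetime spinor bundle, in the frame with index `a`: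
`∇_u ψ = ∂_u ψ + ¼ ∑_{j,k} g(D_u e_j, e_k) e_j e_k ψ`. -/
def spinConn {S : SpinStructure n M κ} {ρ : SpinorModule n Δ}
    (D : CovariantDerivative (model n) (EuclideanSpace ℝ (Fin n))
      (fun x : M => TangentSpace (model n) x))
    (ψ : SpinorField S ρ) (a : κ) (x : M) (u : TangentSpace (model n) x) : Spacetime Δ :=
  mvfderiv (model n) (ψ.rep a) x u +
    (1 / 4 : ℝ) • ∑ j, ∑ k,
      (inner ℝ (D (S.frame a j) x u) (S.frame a k x) : ℝ) • cl ρ j (cl ρ k (ψ.rep a x))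

/-- The equation `∇_i ψ = -½ k_ij e_j e_0 ψ - ½ 𝐢 e_i ψ`. -/
def IsKilling {S : SpinStructure n M κ} {ρ : SpinorModule n Δ}
    (D : CovariantDerivative (model n) (EuclideanSpace ℝ (Fin n))
      (fun x : M => TangentSpace (model n) x))
    (k : (x : M) → TangentSpace (model n) x →L[ℝ] TangentSpace (model n) x →L[ℝ] ℝ)
    (ψ : SpinorField S ρ) : Prop :=
  ∀ a, ∀ x ∈ S.U a, ∀ i,
    spinConn D ψ a x (S.frame a i x) =
      -((1 / 2 : ℝ) • ∑ j, k x (S.frame a i x) (S.frame a j x) • cl ρ j (cl0 (ψ.rep a x)))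
        - (1 / 2 : ℝ) • Complex.I • cl ρ i (ψ.rep a x)

/-! ### The bilinears as tensor fields on `M` -/

namespace SpinorField

variable {S : SpinStructure n M κ} {ρ : SpinorModule n Δ}

/-- The function `N = |ψ|²`. -/
def N (ψ : SpinorField S ρ) (x : M) : ℝ := ‖ψ.rep (S.indexAt x) x‖ ^ 2

/-- The vector field `X = ⟨e_i e_0 ψ, ψ⟩ e_i`. -/
def X (ψ : SpinorField S ρ) (x : M) : TangentSpace (model n) x :=
  ∑ i, Xcomp ρ (ψ.rep (S.indexAt x) x) i • S.frame (S.indexAt x) i x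

/-- The vector field `Y = ⟨𝐢 e_i ψ, ψ⟩ e_i`. -/
def Y (ψ : SpinorField S ρ) (x : M) : TangentSpace (model n) x :=
  ∑ i, Ycomp ρ (ψ.rep (S.indexAt x) x) i • S.frame (S.indexAt x) i x

/-- The two-form `ω` with components `ω_ij = Im ⟨e_i e_j e_0 ψ, ψ⟩`. -/
def omega (ψ : SpinorField S ρ) (x : M) (v w : TangentSpace (model n) x) : ℝ :=
  ∑ i, ∑ j, omegaComp ρ (ψ.rep (S.indexAt x) x) i j *
    inner ℝ (S.frame (S.indexAt x) i x) v * inner ℝ (S.frame (S.indexAt x) j x) w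

end SpinorField

/-! ### Independence of the frame -/

section Independence

lemma SpinorModule.inner_act (ρ : SpinorModule n Δ) (a : Cl n) (φ χ : Δ) :
    inner ℂ (ρ.act a φ) χ = inner ℂ φ (ρ.act (star a) χ) := by
  induction a using CliffordAlgebra.induction generalizing φ χ with
  | algebraMap r => simp [Algebra.algebraMap_eq_smul_one, CliffordAlgebra.star_def]
  | ι v => simp [ρ.skew]
  | mul a b ha hb => simp [ha, hb]
  | add a b ha hb => rw [map_add, star_add, map_add, LinearMap.add_apply, LinearMap.add_apply,
      inner_add_left, inner_add_right, ha, hb]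

lemma inner_diagAct (ρ : SpinorModule n Δ) {a : Cl n} (ha : a ∈ spinGroup (negForm n))
    (φ χ : Spacetime Δ) : inner ℂ (diagAct ρ a φ) (diagAct ρ a χ) = inner ℂ φ χ := by
  have h : ∀ y : Δ, ρ.act (star a) (ρ.act a y) = y := fun y => by
    rw [← Module.End.mul_apply, ← map_mul, spinGroup.star_mul_self_of_mem ha]; simp
  simp [diagAct, ρ.inner_act, h]

lemma diagAct_cl0 (ρ : SpinorModule n Δ) (a : Cl n) (φ : Spacetime Δ) :
    diagAct ρ a (cl0 φ) = cl0 (diagAct ρ a φ) := rfl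

lemma diagAct_cl (ρ : SpinorModule n Δ) {a : Cl n} {A : Fin n → ℝ} {j : Fin n}
    (h : a * gen j = (∑ i, A i • gen i) * a) (φ : Spacetime Δ) :
    diagAct ρ a (cl ρ j φ) = ∑ i, A i • cl ρ i (diagAct ρ a φ) := by
  have h' : ∀ y : Δ, ρ.act a (ρ.act (gen j) y) = ∑ i, A i • ρ.act (gen i) (ρ.act a y) := by
    intro y
    have := congrArg (fun b => ρ.act b y) h
    simpa [Finset.sum_mul] using this
  apply WithLp.ofLp_injective
  rw [WithLp.ofLp_sum]
  ext
  · simp [diagAct, cl, h', Prod.fst_sum]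
  · simp [diagAct, cl, h', Prod.snd_sum]

variable {S : SpinStructure n M κ} {ρ : SpinorModule n Δ}

lemma SpinorField.inner_rep (ψ : SpinorField S ρ) {a b : κ} {x : M} (hx : x ∈ S.U a ∩ S.U b)
    (φ : Spacetime Δ) :
    inner ℂ (ψ.rep b x) φ = inner ℂ (ψ.rep a x) (diagAct ρ (S.trans a b x) φ) := by
  rw [ψ.compat a b x hx, inner_diagAct ρ (S.trans_mem a b x hx)]

lemma SpinorField.Xcomp_rep (ψ : SpinorField S ρ) {a b : κ} {x : M} (hx : x ∈ S.U a ∩ S.U b)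
    (j : Fin n) : Xcomp ρ (ψ.rep b x) j =
      ∑ i, inner ℝ (S.frame a i x) (S.frame b j x) * Xcomp ρ (ψ.rep a x) i := by
  rw [Xcomp, ψ.inner_rep hx, diagAct_cl ρ (S.trans_lifts a b x hx j), diagAct_cl0,
    ← ψ.compat a b x hx]
  simp [Xcomp, ← Complex.coe_smul]

lemma SpinorField.Ycomp_rep (ψ : SpinorField S ρ) {a b : κ} {x : M} (hx : x ∈ S.U a ∩ S.U b)
    (j : Fin n) : Ycomp ρ (ψ.rep b x) j =
      ∑ i, inner ℝ (S.frame a i x) (S.frame b j x) * Ycomp ρ (ψ.rep a x) i := by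
  have hI : ∀ (χ : Spacetime Δ) (r : ℝ),
      (inner ℂ (ψ.rep a x) (Complex.I • r • χ)).re =
        r * (inner ℂ (ψ.rep a x) (Complex.I • χ)).re := by
    intro χ r
    rw [smul_comm, ← Complex.coe_smul, inner_smul_right, Complex.re_ofReal_mul]
  rw [Ycomp, inner_smul_right, ψ.inner_rep hx, diagAct_cl ρ (S.trans_lifts a b x hx j),
    ← ψ.compat a b x hx, ← inner_smul_right, Finset.smul_sum, inner_sum, Complex.re_sum]
  simp only [hI, Ycomp]

lemma SpinorField.omegaComp_rep (ψ : SpinorField S ρ) {a b : κ} {x : M}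
    (hx : x ∈ S.U a ∩ S.U b) (i j : Fin n) : omegaComp ρ (ψ.rep b x) i j =
      ∑ p, ∑ q, inner ℝ (S.frame a p x) (S.frame b i x) *
        (inner ℝ (S.frame a q x) (S.frame b j x) * omegaComp ρ (ψ.rep a x) p q) := by
  have hcl : ∀ (p : Fin n) (c : Fin n → ℝ) (f : Fin n → Spacetime Δ),
      cl ρ p (∑ q, c q • f q) = ∑ q, c q • cl ρ p (f q) := by
    intro p c f
    have hact : ∀ g : Fin n → Δ,
        ρ.act (gen p) (∑ q, c q • g q) = ∑ q, c q • ρ.act (gen p) (g q) := by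
      intro g
      simp only [map_sum, ← Complex.coe_smul, map_smul]
    apply WithLp.ofLp_injective
    rw [WithLp.ofLp_sum]
    ext
    · have h1 : (∑ q, c q • f q).fst = ∑ q, c q • (f q).fst := by
        rw [WithLp.fst, WithLp.ofLp_sum, Prod.fst_sum]; rfl
      simp only [cl, h1, hact, Prod.fst_sum]; rfl
    · have h2 : (∑ q, c q • f q).snd = ∑ q, c q • (f q).snd := by
        rw [WithLp.snd, WithLp.ofLp_sum, Prod.snd_sum]; rfl
      simp only [cl, h2, hact, Prod.snd_sum, WithLp.ofLp_smul, Prod.smul_snd, smul_neg,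
        Finset.sum_neg_distrib]
  have him : ∀ (χ : Spacetime Δ) (r : ℝ),
      (inner ℂ (ψ.rep a x) (r • χ)).im = r * (inner ℂ (ψ.rep a x) χ).im := by
    intro χ r
    rw [← Complex.coe_smul, inner_smul_right, Complex.im_ofReal_mul]
  rw [omegaComp, ψ.inner_rep hx, diagAct_cl ρ (S.trans_lifts a b x hx i),
    diagAct_cl ρ (S.trans_lifts a b x hx j), diagAct_cl0, ← ψ.compat a b x hx,
    inner_sum, Complex.im_sum]
  simp only [hcl, him, inner_sum, Complex.im_sum, omegaComp, Finset.mul_sum]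

lemma SpinStructure.sum_frame (S : SpinStructure n M κ) {b : κ} {x : M} (hx : x ∈ S.U b)
    (v : TangentSpace (model n) x) :
    ∑ j, inner ℝ v (S.frame b j x) • S.frame b j x = v := by
  have hcard : Fintype.card (Fin n) = Module.finrank ℝ (TangentSpace (model n) x) := by
    have : Module.finrank ℝ (TangentSpace (model n) x) =
      Module.finrank ℝ (EuclideanSpace ℝ (Fin n)) := rfl
    rw [this]; simp
  have : FiniteDimensional ℝ (TangentSpace (model n) x) :=
    inferInstanceAs (FiniteDimensional ℝ (EuclideanSpace ℝ (Fin n)))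
  have ho := S.frame_orthonormal b x hx
  let e := OrthonormalBasis.mk ho
    (ho.linearIndependent.span_eq_top_of_card_eq_finrank' hcard).ge
  have he : ∀ j, e j = S.frame b j x := fun j => by simp [e]
  have := e.sum_repr' v
  simp only [he] at this
  simpa [real_inner_comm] using this

/-- The function `N` may be computed in any frame of the spin structure. -/
lemma SpinorField.N_eq (ψ : SpinorField S ρ) {a : κ} {x : M} (hx : x ∈ S.U a) :
    ψ.N x = ‖ψ.rep a x‖ ^ 2 := by
  have hab : x ∈ S.U a ∩ S.U (S.indexAt x) := ⟨hx, (S.cover x).choose_spec⟩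
  rw [SpinorField.N, ← inner_self_eq_norm_sq (𝕜 := ℂ), ← inner_self_eq_norm_sq (𝕜 := ℂ),
    ψ.inner_rep hab, ← ψ.compat _ _ x hab]

/-- The vector field `X` may be computed in any frame of the spin structure. -/
lemma SpinorField.X_eq (ψ : SpinorField S ρ) {a : κ} {x : M} (hx : x ∈ S.U a) :
    ψ.X x = ∑ i, Xcomp ρ (ψ.rep a x) i • S.frame a i x := by
  have hb : x ∈ S.U (S.indexAt x) := (S.cover x).choose_spec
  simp only [SpinorField.X, ψ.Xcomp_rep ⟨hx, hb⟩, Finset.sum_smul]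
  rw [Finset.sum_comm]
  refine Finset.sum_congr rfl fun i _ => ?_
  conv_rhs => rw [← S.sum_frame hb (S.frame a i x), Finset.smul_sum]
  exact Finset.sum_congr rfl fun j _ => by rw [smul_smul, mul_comm]

/-- The vector field `Y` may be computed in any frame of the spin structure. -/
lemma SpinorField.Y_eq (ψ : SpinorField S ρ) {a : κ} {x : M} (hx : x ∈ S.U a) :
    ψ.Y x = ∑ i, Ycomp ρ (ψ.rep a x) i • S.frame a i x := by
  have hb : x ∈ S.U (S.indexAt x) := (S.cover x).choose_spec
  simp only [SpinorField.Y, ψ.Ycomp_rep ⟨hx, hb⟩, Finset.sum_smul]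
  rw [Finset.sum_comm]
  refine Finset.sum_congr rfl fun i _ => ?_
  conv_rhs => rw [← S.sum_frame hb (S.frame a i x), Finset.smul_sum]
  exact Finset.sum_congr rfl fun j _ => by rw [smul_smul, mul_comm]

/-- The two-form `ω` may be computed in any frame of the spin structure. -/
lemma SpinorField.omega_eq (ψ : SpinorField S ρ) {a : κ} {x : M} (hx : x ∈ S.U a)
    (v w : TangentSpace (model n) x) :
    ψ.omega x v w = ∑ i, ∑ j, omegaComp ρ (ψ.rep a x) i j *
      inner ℝ (S.frame a i x) v * inner ℝ (S.frame a j x) w := by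
  have hb : x ∈ S.U (S.indexAt x) := (S.cover x).choose_spec
  have hinner : ∀ (p : Fin n) (z : TangentSpace (model n) x),
      inner ℝ (S.frame a p x) z = ∑ i, inner ℝ (S.frame a p x) (S.frame (S.indexAt x) i x) *
        inner ℝ (S.frame (S.indexAt x) i x) z := by
    intro p z
    conv_lhs => rw [← S.sum_frame hb (S.frame a p x), sum_inner]
    simp [inner_smul_left]
  have key : ∀ (A O : Fin n → Fin n → ℝ) (r s : Fin n → ℝ),
      ∑ i, ∑ j, (∑ p, ∑ q, A p i * (A q j * O p q)) * r i * s j =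
        ∑ p, ∑ q, O p q * (∑ i, A p i * r i) * (∑ j, A q j * s j) := by
    intro A O r s
    calc _ = ∑ i, ∑ j, ∑ p, ∑ q, O p q * (A p i * r i) * (A q j * s j) := by
          simp only [Finset.sum_mul]
          refine Finset.sum_congr rfl fun i _ => Finset.sum_congr rfl fun j _ =>
            Finset.sum_congr rfl fun p _ => Finset.sum_congr rfl fun q _ => by ring
      _ = ∑ p, ∑ i, ∑ j, ∑ q, O p q * (A p i * r i) * (A q j * s j) := by
          exact (Finset.sum_congr rfl fun i _ => Finset.sum_comm).trans Finset.sum_comm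
      _ = ∑ p, ∑ q, ∑ i, ∑ j, O p q * (A p i * r i) * (A q j * s j) := by
          refine Finset.sum_congr rfl fun p _ => ?_
          exact (Finset.sum_congr rfl fun i _ => Finset.sum_comm).trans Finset.sum_comm
      _ = _ := by
          simp only [Finset.sum_mul, Finset.mul_sum]
          exact Finset.sum_congr rfl fun p _ => Finset.sum_congr rfl fun q _ => Finset.sum_comm
  simp only [SpinorField.omega, ψ.omegaComp_rep ⟨hx, hb⟩]
  rw [key]
  refine Finset.sum_congr rfl fun p _ => Finset.sum_congr rfl fun q _ => ?_
  rw [← hinner p v, ← hinner q w]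

end Independence

/-- The covariant derivative of a two-tensor `τ`, in the direction `u`, evaluated on vector fields:
`(∇_u τ)(V, W) = ∂_u (τ(V, W)) - τ(∇_u V, W) - τ(V, ∇_u W)`. -/
def covDeriv₂
    (D : CovariantDerivative (model n) (EuclideanSpace ℝ (Fin n))
      (fun x : M => TangentSpace (model n) x))
    (τ : (x : M) → TangentSpace (model n) x → TangentSpace (model n) x → ℝ)
    (V W : (x : M) → TangentSpace (model n) x) (x : M) (u : TangentSpace (model n) x) : ℝ :=
  mvfderiv (model n) (fun y => τ y (V y) (W y)) x u - τ x (D V x u) (W x) - τ x (V x) (D W x u)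

end KillingBilinears

end

noncomputable section

namespace KillingBilinears

/-! ### Commutators in a Clifford algebra -/

section CliffordRelations

variable {R : Type*} [Ring R] [Algebra ℂ R] {n : ℕ} {E : Fin n → R} {E₀ : R}

/-! In a local orthonormal frame the Killing equation, solved for the ordinary derivative in a
direction `u`, reads `∂_u ψ = -Ωψ - ½Tψ`. Here `Ω = ¼ A_pq e_p e_q`, with `A_pq = ⟨D_u e_p, e_q⟩`,
is skew-adjoint because `A` is antisymmetric, and `T = k(u, e_l) e_l e_0 + 𝐢 u_l e_l` is
self-adjoint (`mvfderiv_rep`, `inner_rotOp`, `inner_killOp`). Hence for every fixed operator `B`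
`∂_u ⟨Bψ, ψ⟩ = ⟨[Ω, B]ψ, ψ⟩ - ½ ⟨{B, T}ψ, ψ⟩`, which is `inner_apply_add_inner_apply`.

The four bilinears are the cases `B = 1`, `e_j e_0`, `𝐢 e_j`, `e_j e_k e_0`. The commutator with `Ω`
only rotates the frame indices of `B` by `A`, which is what the Levi-Civita derivative of the tensor
compensates (`covariantDerivative_of_components`, `sum_two_form_derivative`). The anticommutator
with `T` follows from the Clifford relations and is again a combination of the four types, so the
system closes (`anticommutator_vec`, `anticommutator_ivec`, `anticommutator_form`).

For the conserved quantity, the derivative of `N² - |X|² - |Y|² + ½|ω|²` is computed in frame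
components. The connection terms vanish by antisymmetry and the others cancel in pairs
(`conserved_identity`). The expression does not depend on the frame, so it is a global function with
zero derivative on a connected manifold. -/

lemma anticomm_sum (hE : ∀ i j, E i * E j + E j * E i = if i = j then -2 else 0)
    (c : Fin n → ℂ) (j : Fin n) :
    (∑ l, c l • E l) * E j + E j * (∑ l, c l • E l) = -(2 : ℂ) • c j • (1 : R) := by
  rw [Finset.sum_mul, Finset.mul_sum, ← Finset.sum_add_distrib]
  have h : ∀ l, c l • E l * E j + E j * c l • E l = if l = j then c l • (-2 : R) else 0 := by
    intro l
    rw [smul_mul_assoc, mul_smul_comm, ← smul_add, hE]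
    split_ifs <;> simp
  simp only [h, Finset.sum_ite_eq', Finset.mem_univ, if_true]
  rw [smul_comm, neg_smul, two_smul, one_add_one_eq_two]

lemma anticomm_sum_zero (h₀ : ∀ j, E₀ * E j = -(E j * E₀)) (c : Fin n → ℂ) :
    E₀ * (∑ l, c l • E l) = -((∑ l, c l • E l) * E₀) := by
  simp [Finset.sum_mul, Finset.mul_sum, h₀]

/-- For a vector `v`, `[v, e_j e_k] = {v, e_j} e_k - e_j {v, e_k}`, and both anticommutators are
scalars. -/
lemma commutator_sum (hE : ∀ i j, E i * E j + E j * E i = if i = j then -2 else 0)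
    (c : Fin n → ℂ) (j k : Fin n) :
    (∑ l, c l • E l) * (E j * E k) - E j * E k * (∑ l, c l • E l) =
      (2 : ℂ) • (c k • E j - c j • E k) := by
  have h1 := anticomm_sum hE c j
  have h2 := anticomm_sum hE c k
  have h3 : (-(2 : ℂ) • c j • (1 : R)) * E k - E j * (-(2 : ℂ) • c k • (1 : R)) =
      (2 : ℂ) • (c k • E j - c j • E k) := by
    simp only [smul_mul_assoc, mul_smul_comm, one_mul, mul_one]; module
  rw [← h3, ← h1, ← h2]
  noncomm_ring

/-- The spin Lie algebra acts on vectors as infinitesimal rotations. Since `[e_p e_q, e_l] = e_p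
{e_q, e_l} - {e_p, e_l} e_q`, only `q = l` and `p = l` contribute, each with a factor 2.
Antisymmetry of `A` makes the two contributions equal, and `¼` absorbs the total factor 4. -/
lemma commutator_rotation (hE : ∀ i j, E i * E j + E j * E i = if i = j then -2 else 0)
    {A : Fin n → Fin n → ℂ} (hA : ∀ i j, A i j = -A j i) (l : Fin n) :
    ((1 / 4 : ℂ) • ∑ p, ∑ q, A p q • (E p * E q)) * E l -
      E l * ((1 / 4 : ℂ) • ∑ p, ∑ q, A p q • (E p * E q)) = ∑ k, A l k • E k := by
  have h : ∀ p q, E p * E q * E l - E l * (E p * E q) =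
      (if q = l then (-2 : ℂ) • E p else 0) + if p = l then (2 : ℂ) • E q else 0 := by
    intro p q
    have e : E p * E q * E l - E l * (E p * E q) =
      E p * (E q * E l + E l * E q) - (E p * E l + E l * E p) * E q := by noncomm_ring
    rw [e, hE, hE]
    split_ifs <;> simp [two_smul, mul_two, two_mul, sub_eq_add_neg]
  have h' : ∀ p q, A p q • (E p * E q) * E l - E l * A p q • (E p * E q) =
      (if q = l then A p q • (-2 : ℂ) • E p else 0) +
        if p = l then A p q • (2 : ℂ) • E q else 0 := by
    intro p q
    rw [smul_mul_assoc, mul_smul_comm, ← smul_sub, h, smul_add, smul_ite, smul_ite, smul_zero]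
  rw [smul_mul_assoc, mul_smul_comm, ← smul_sub, Finset.sum_mul, Finset.mul_sum,
    ← Finset.sum_sub_distrib]
  simp only [Finset.sum_mul, Finset.mul_sum, ← Finset.sum_sub_distrib, h',
    Finset.sum_add_distrib, Finset.sum_ite_eq', Finset.mem_univ, if_true]
  rw [Finset.sum_comm (f := fun p q => if p = l then A p q • (2 : ℂ) • E q else 0)]
  simp only [Finset.sum_ite_eq', Finset.mem_univ, if_true]
  rw [← Finset.sum_add_distrib, Finset.smul_sum]
  refine Finset.sum_congr rfl fun k _ => ?_
  rw [hA k l]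
  module

/-- Two sign changes cancel when `e_0` passes an even product `e_p e_q`. -/
lemma commute_rotation_zero (h₀ : ∀ j, E₀ * E j = -(E j * E₀)) (A : Fin n → Fin n → ℂ) :
    ((1 / 4 : ℂ) • ∑ p, ∑ q, A p q • (E p * E q)) * E₀ =
      E₀ * ((1 / 4 : ℂ) • ∑ p, ∑ q, A p q • (E p * E q)) := by
  have h : ∀ p q, E p * E q * E₀ = E₀ * (E p * E q) := fun p q => by
    rw [← mul_assoc, h₀, neg_mul, mul_assoc (E p) E₀, h₀, mul_neg, neg_neg, mul_assoc]
  simp only [smul_mul_assoc, mul_smul_comm, Finset.sum_mul, Finset.mul_sum, h]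

lemma commutator_rotation_vec (hE : ∀ i j, E i * E j + E j * E i = if i = j then -2 else 0)
    (h₀ : ∀ j, E₀ * E j = -(E j * E₀))
    {A : Fin n → Fin n → ℂ} (hA : ∀ i j, A i j = -A j i) (l : Fin n) :
    ((1 / 4 : ℂ) • ∑ p, ∑ q, A p q • (E p * E q)) * (E l * E₀) -
      (E l * E₀) * ((1 / 4 : ℂ) • ∑ p, ∑ q, A p q • (E p * E q)) =
      ∑ k, A l k • (E k * E₀) := by
  have h1 := commutator_rotation hE hA l
  have h2 := commute_rotation_zero h₀ A
  have h3 : ∑ k, A l k • (E k * E₀) = (∑ k, A l k • E k) * E₀ := by simp [Finset.sum_mul]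
  rw [h3, ← h1, mul_assoc, ← h2]
  noncomm_ring

/-- `[Ω, ·]` is a derivation that kills `e_0`, so each of the indices `j` and `k` is rotated in
turn. -/
lemma commutator_rotation_form (hE : ∀ i j, E i * E j + E j * E i = if i = j then -2 else 0)
    (h₀ : ∀ j, E₀ * E j = -(E j * E₀))
    {A : Fin n → Fin n → ℂ} (hA : ∀ i j, A i j = -A j i) (j k : Fin n) :
    ((1 / 4 : ℂ) • ∑ p, ∑ q, A p q • (E p * E q)) * (E j * (E k * E₀)) -
      (E j * (E k * E₀)) * ((1 / 4 : ℂ) • ∑ p, ∑ q, A p q • (E p * E q)) =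
      (∑ p, A j p • (E p * (E k * E₀))) + ∑ p, A k p • (E j * (E p * E₀)) := by
  have h1 := commutator_rotation hE hA j
  have h2 := commutator_rotation_vec hE h₀ hA k
  have h3 : ∑ p, A j p • (E p * (E k * E₀)) = (∑ p, A j p • E p) * (E k * E₀) := by
    simp [Finset.sum_mul]
  have h4 : ∑ p, A k p • (E j * (E p * E₀)) = E j * (∑ p, A k p • (E p * E₀)) := by
    simp [Finset.mul_sum]
  rw [h3, h4, ← h1, ← h2]
  noncomm_ring

/-- The anticommutator of `e_j e_0` with the operator `K e_0 + 𝐢 U`. -/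
lemma anticommutator_vec (hE : ∀ i j, E i * E j + E j * E i = if i = j then -2 else 0)
    (h₀ : ∀ j, E₀ * E j = -(E j * E₀)) (h00 : E₀ * E₀ = 1) (c u : Fin n → ℂ) (j : Fin n) :
    E j * E₀ * ((∑ l, c l • E l) * E₀ + Complex.I • ∑ l, u l • E l) +
      ((∑ l, c l • E l) * E₀ + Complex.I • ∑ l, u l • E l) * (E j * E₀) =
      (2 : ℂ) • c j • (1 : R) +
        Complex.I • ∑ l, u l • (E l * (E j * E₀) - E j * (E l * E₀)) := by
  have h1 := anticomm_sum hE c j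
  have h2 := anticomm_sum_zero h₀ c
  have h3 := anticomm_sum_zero h₀ u
  have h4 : ∑ l, u l • (E l * (E j * E₀) - E j * (E l * E₀)) =
      (∑ l, u l • E l) * (E j * E₀) - E j * ((∑ l, u l • E l) * E₀) := by
    simp [Finset.sum_mul, Finset.mul_sum, smul_sub]
  -- Moving the inner `e_0` outwards turns the `K e_0` part into `-{K, e_j} e_0²`, a scalar. In the
  -- `U` part the same move leaves a difference of products, hence a two-index term.
  have h5 : E j * E₀ * ((∑ l, c l • E l) * E₀) + (∑ l, c l • E l) * E₀ * (E j * E₀) =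
      (2 : ℂ) • c j • (1 : R) := by
    calc _ = E j * (E₀ * ∑ l, c l • E l) * E₀ + (∑ l, c l • E l) * (E₀ * E j) * E₀ := by
          noncomm_ring
      _ = -((∑ l, c l • E l) * E j + E j * (∑ l, c l • E l)) * (E₀ * E₀) := by
          rw [h2, h₀]; noncomm_ring
      _ = _ := by rw [h1, h00]; simp
  have h6 : E j * E₀ * (∑ l, u l • E l) = -(E j * ((∑ l, u l • E l) * E₀)) := by
    rw [mul_assoc, h3, mul_neg]
  rw [h4, ← h5, mul_add, add_mul, mul_smul_comm, smul_mul_assoc, h6]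
  module

/-- The anticommutator of `𝐢 e_j` with the operator `K e_0 + 𝐢 U`. -/
lemma anticommutator_ivec (hE : ∀ i j, E i * E j + E j * E i = if i = j then -2 else 0)
    (h₀ : ∀ j, E₀ * E j = -(E j * E₀)) (c u : Fin n → ℂ) (j : Fin n) :
    Complex.I • E j * ((∑ l, c l • E l) * E₀ + Complex.I • ∑ l, u l • E l) +
      ((∑ l, c l • E l) * E₀ + Complex.I • ∑ l, u l • E l) * (Complex.I • E j) =
      (2 : ℂ) • u j • (1 : R) +
        Complex.I • ∑ l, c l • (E j * (E l * E₀) - E l * (E j * E₀)) := by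
  have h1 := anticomm_sum hE u j
  have h4 : ∑ l, c l • (E j * (E l * E₀) - E l * (E j * E₀)) =
      E j * ((∑ l, c l • E l) * E₀) - (∑ l, c l • E l) * (E j * E₀) := by
    simp [Finset.sum_mul, Finset.mul_sum, smul_sub]
  have h5 : (∑ l, c l • E l) * E₀ * E j = -((∑ l, c l • E l) * (E j * E₀)) := by
    rw [mul_assoc, h₀, mul_neg]
  -- The roles are exchanged compared with `e_j e_0`: the two factors `𝐢` give `-{e_j, U}`, so now
  -- the `U` part is the scalar one.
  have h6 : (2 : ℂ) • u j • (1 : R) =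
      -((∑ l, u l • E l) * E j + E j * (∑ l, u l • E l)) := by rw [h1]; module
  rw [h4, h6]
  simp only [mul_add, add_mul, mul_smul_comm, smul_mul_assoc, h5, smul_add, smul_smul,
    Complex.I_mul_I]
  module

/-- The anticommutator of `e_j e_k e_0` with the operator `K e_0 + 𝐢 U`. -/
lemma anticommutator_form (hE : ∀ i j, E i * E j + E j * E i = if i = j then -2 else 0)
    (h₀ : ∀ j, E₀ * E j = -(E j * E₀)) (h00 : E₀ * E₀ = 1) (c u : Fin n → ℂ) (j k : Fin n) :
    E j * (E k * E₀) * ((∑ l, c l • E l) * E₀ + Complex.I • ∑ l, u l • E l) +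
      ((∑ l, c l • E l) * E₀ + Complex.I • ∑ l, u l • E l) * (E j * (E k * E₀)) =
      (2 : ℂ) • (c k • E j - c j • E k) +
        (2 : ℂ) • Complex.I • (u k • (E j * E₀) - u j • (E k * E₀)) := by
  have h1 := commutator_sum hE c j k
  have h2 := anticomm_sum_zero h₀ c
  have h3 := anticomm_sum_zero h₀ u
  have h4 : (2 : ℂ) • Complex.I • (u k • (E j * E₀) - u j • (E k * E₀)) =
      Complex.I • (((2 : ℂ) • (u k • E j - u j • E k)) * E₀) := by
    rw [smul_mul_assoc, sub_mul, smul_mul_assoc, smul_mul_assoc, smul_comm]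
  -- `e_0` commutes with `e_j e_k` but anticommutes with vectors, so both anticommutators reduce to
  -- commutators of a vector with `e_j e_k`: `[K, e_j e_k]` and `𝐢 [U, e_j e_k] e_0`.
  have h5 : E j * (E k * E₀) * ((∑ l, c l • E l) * E₀) = -(E j * E k * ∑ l, c l • E l) := by
    calc _ = E j * E k * (E₀ * ∑ l, c l • E l) * E₀ := by noncomm_ring
      _ = -(E j * E k * (∑ l, c l • E l) * (E₀ * E₀)) := by rw [h2]; noncomm_ring
      _ = _ := by rw [h00, mul_one]
  have h6 : E j * (E k * E₀) * (∑ l, u l • E l) = -(E j * E k * (∑ l, u l • E l) * E₀) := by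
    calc _ = E j * E k * (E₀ * ∑ l, u l • E l) := by noncomm_ring
      _ = _ := by rw [h3]; noncomm_ring
  have h7 : (∑ l, c l • E l) * E₀ * (E j * (E k * E₀)) = (∑ l, c l • E l) * (E j * E k) := by
    calc _ = (∑ l, c l • E l) * ((E₀ * E j) * E k * E₀) := by noncomm_ring
      _ = -((∑ l, c l • E l) * (E j * (E₀ * E k) * E₀)) := by rw [h₀]; noncomm_ring
      _ = (∑ l, c l • E l) * (E j * E k) * (E₀ * E₀) := by rw [h₀]; noncomm_ring
      _ = _ := by rw [h00, mul_one]
  rw [h4, ← commutator_sum hE u j k, ← h1, mul_add, add_mul, mul_smul_comm, smul_mul_assoc,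
    h5, h6, h7, sub_mul, ← mul_assoc (E j) (E k) E₀, ← mul_assoc _ (E j * E k) E₀]
  module

end CliffordRelations

variable {n : ℕ} {Δ : Type*} [NormedAddCommGroup Δ] [InnerProductSpace ℂ Δ]

/-! ### Clifford multiplication on spacetime spinors as operators -/

/-- Clifford multiplication by `e_i` on `Δ ⊕ Δ`, as an operator. -/
def clOp (ρ : SpinorModule n Δ) (i : Fin n) : Module.End ℂ (Spacetime Δ) where
  toFun := cl ρ i
  map_add' φ χ := by
    apply WithLp.ofLp_injective
    ext
    · simp [cl]
    · simp [cl, add_comm]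
  map_smul' c φ := by
    apply WithLp.ofLp_injective
    ext <;> simp [cl]

/-- Clifford multiplication by `e_0` on `Δ ⊕ Δ`, as an operator. -/
def clOp₀ (Δ : Type*) [NormedAddCommGroup Δ] [InnerProductSpace ℂ Δ] :
    Module.End ℂ (Spacetime Δ) where
  toFun := cl0
  map_add' _ _ := rfl
  map_smul' _ _ := rfl

@[simp] lemma clOp_apply (ρ : SpinorModule n Δ) (i : Fin n) (φ : Spacetime Δ) :
    clOp ρ i φ = cl ρ i φ := rfl

@[simp] lemma clOp₀_apply (φ : Spacetime Δ) : clOp₀ Δ φ = cl0 φ := rfl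

lemma gen_mul_gen_add_swap (i j : Fin n) :
    (gen i * gen j + gen j * gen i : Cl n) = algebraMap ℝ (Cl n) (if i = j then -2 else 0) := by
  rw [gen, gen, CliffordAlgebra.ι_mul_ι_add_swap, QuadraticMap.polar]
  congr 1
  simp only [negForm, LinearMap.BilinMap.toQuadraticMap_apply, LinearMap.neg_apply,
    innerₗ_apply_apply, inner_add_left, inner_add_right, EuclideanSpace.inner_single_left]
  by_cases h : i = j
  · subst h; simp; norm_num
  · simp [h, Ne.symm h]

/-- The extra sign on the second summand occurs twice in each product, so the relations of the `gen
i` hold on both summands. -/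
lemma clOp_mul_add_swap (ρ : SpinorModule n Δ) (i j : Fin n) :
    clOp ρ i * clOp ρ j + clOp ρ j * clOp ρ i = if i = j then -2 else 0 := by
  have h : ∀ y : Δ, ρ.act (gen i) (ρ.act (gen j) y) + ρ.act (gen j) (ρ.act (gen i) y) =
      if i = j then -((2 : ℕ) • y) else 0 := by
    intro y
    have := congrArg (fun b => ρ.act b y) (gen_mul_gen_add_swap i j)
    simp only [map_add, map_mul, LinearMap.add_apply, Module.End.mul_apply,
      AlgHom.commutes] at this
    rw [this, Module.algebraMap_end_apply]
    split_ifs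
    · rw [neg_smul, two_smul, two_smul]
    · simp
  refine LinearMap.ext fun φ => ?_
  apply WithLp.ofLp_injective
  ext
  · have := h φ.fst
    split_ifs at this ⊢ <;> simpa [cl] using this
  · have := h φ.snd
    split_ifs at this ⊢ <;> simpa [cl] using this

lemma clOp₀_mul_clOp (ρ : SpinorModule n Δ) (j : Fin n) :
    clOp₀ Δ * clOp ρ j = -(clOp ρ j * clOp₀ Δ) := by
  refine LinearMap.ext fun φ => ?_
  apply WithLp.ofLp_injective
  ext <;> simp [cl, cl0]

lemma clOp₀_mul_clOp₀ : clOp₀ Δ * clOp₀ Δ = 1 := rfl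

lemma inner_clOp (ρ : SpinorModule n Δ) (i : Fin n) (φ χ : Spacetime Δ) :
    inner ℂ (clOp ρ i φ) χ = -inner ℂ φ (clOp ρ i χ) := by
  simp [cl, gen, ρ.skew, add_comm]

lemma inner_clOp₀ (φ χ : Spacetime Δ) : inner ℂ (clOp₀ Δ φ) χ = inner ℂ φ (clOp₀ Δ χ) := by
  simp [cl0, add_comm]

/-! ### The operators of an infinitesimal rotation and of the Killing equation -/

/-- The operator `¼ A_pq e_p e_q`. -/
def rotOp (ρ : SpinorModule n Δ) (A : Fin n → Fin n → ℝ) : Module.End ℂ (Spacetime Δ) :=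
  (1 / 4 : ℂ) • ∑ p, ∑ q, (A p q : ℂ) • (clOp ρ p * clOp ρ q)

/-- The operator `c_l e_l e_0 + 𝐢 u_l e_l`. -/
def killOp (ρ : SpinorModule n Δ) (c u : Fin n → ℝ) : Module.End ℂ (Spacetime Δ) :=
  (∑ l, (c l : ℂ) • clOp ρ l) * clOp₀ Δ + Complex.I • ∑ l, (u l : ℂ) • clOp ρ l

/-- The adjoint of `e_p e_q` is `e_q e_p`; exchanging the summation indices then costs one sign by
antisymmetry of `A`. -/
lemma inner_rotOp (ρ : SpinorModule n Δ) {A : Fin n → Fin n → ℝ} (hA : ∀ i j, A i j = -A j i)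
    (φ χ : Spacetime Δ) : inner ℂ (rotOp ρ A φ) χ = -inner ℂ φ (rotOp ρ A χ) := by
  have h : ∀ p q, (starRingEnd ℂ) (A p q : ℂ) * inner ℂ (clOp ρ p (clOp ρ q φ)) χ =
      -((A q p : ℂ) * inner ℂ φ (clOp ρ q (clOp ρ p χ))) := by
    intro p q
    rw [inner_clOp, inner_clOp, hA q p, Complex.conj_ofReal]
    push_cast
    ring
  simp only [rotOp, LinearMap.smul_apply, LinearMap.sum_apply, Module.End.mul_apply,
    inner_smul_left, inner_smul_right, sum_inner, inner_sum, h, Finset.sum_neg_distrib,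
    map_div₀, map_one, map_ofNat, mul_neg]
  rw [Finset.sum_comm]

/-- `e_l` is skew-adjoint, `e_0` is self-adjoint and they anticommute, so `e_l e_0` and `𝐢 e_l` are
both self-adjoint; the coefficients are real. -/
lemma inner_killOp (ρ : SpinorModule n Δ) (c u : Fin n → ℝ) (φ χ : Spacetime Δ) :
    inner ℂ (killOp ρ c u φ) χ = inner ℂ φ (killOp ρ c u χ) := by
  have h : ∀ l (a b : Spacetime Δ), inner ℂ (clOp ρ l (clOp₀ Δ a)) b =
      inner ℂ a (clOp ρ l (clOp₀ Δ b)) := by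
    intro l a b
    rw [inner_clOp, inner_clOp₀, ← inner_neg_right]
    congr 1
    have := congrArg (fun T => T b) (clOp₀_mul_clOp ρ l)
    simp only [Module.End.mul_apply, LinearMap.neg_apply] at this
    rw [this, neg_neg]
  simp only [killOp, LinearMap.add_apply, LinearMap.smul_apply, LinearMap.sum_apply,
    Module.End.mul_apply, inner_add_left, inner_add_right, inner_smul_left, inner_smul_right,
    sum_inner, inner_sum, h, Complex.conj_ofReal, Complex.conj_I]
  simp only [inner_clOp, mul_neg, neg_mul, Finset.sum_neg_distrib, neg_neg]

/-- The derivative of `⟨Aψ, ψ⟩` in the direction `-Ωψ - ½Tψ`. -/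
lemma inner_apply_add_inner_apply {V : Type*} [NormedAddCommGroup V] [InnerProductSpace ℂ V]
    {Ω T : Module.End ℂ V} (hΩ : ∀ φ χ, inner ℂ (Ω φ) χ = -inner ℂ φ (Ω χ))
    (hT : ∀ φ χ, inner ℂ (T φ) χ = inner ℂ φ (T χ)) (A : Module.End ℂ V) (φ : V) :
    inner ℂ φ (A (-Ω φ - (1 / 2 : ℂ) • T φ)) + inner ℂ (-Ω φ - (1 / 2 : ℂ) • T φ) (A φ) =
      inner ℂ φ ((Ω * A - A * Ω) φ) - 1 / 2 * inner ℂ φ ((A * T + T * A) φ) := by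
  simp only [map_sub, map_neg, map_smul, inner_sub_right, inner_sub_left, inner_neg_left,
    inner_neg_right, inner_smul_left, inner_smul_right, hΩ, hT, LinearMap.sub_apply,
    LinearMap.add_apply, Module.End.mul_apply, inner_add_right]
  simp only [map_div₀, map_one, map_ofNat]
  ring

/-! ### Variation of the bilinears -/

/-- The symmetric part of `e_i e_j e_0` is `-δ_ij e_0`, whose expectation is real because `e_0` is
self-adjoint; the imaginary part discards it. -/
lemma omegaComp_antisymm (ρ : SpinorModule n Δ) (φ : Spacetime Δ) (i j : Fin n) :
    omegaComp ρ φ i j = -omegaComp ρ φ j i := by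
  have h0 : (inner ℂ φ (clOp₀ Δ φ)).im = 0 := by
    have h := inner_conj_symm (𝕜 := ℂ) φ (clOp₀ Δ φ)
    rw [inner_clOp₀] at h
    exact Complex.conj_eq_iff_im.mp h
  have h1 := congrArg (fun T => (inner ℂ φ ((T * clOp₀ Δ) φ)).im) (clOp_mul_add_swap ρ i j)
  have h3 : omegaComp ρ φ i j + omegaComp ρ φ j i = 0 := by
    rw [omegaComp, omegaComp, ← Complex.add_im, ← inner_add_right]
    refine h1.trans ?_
    split_ifs
    · rw [Module.End.mul_apply, LinearMap.neg_apply, Module.End.ofNat_apply, two_smul,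
        inner_neg_right, inner_add_right, Complex.neg_im, Complex.add_im, h0, add_zero, neg_zero]
    · simp
  linarith

lemma im_inner_clOp (ρ : SpinorModule n Δ) (φ : Spacetime Δ) (i : Fin n) :
    (inner ℂ φ (clOp ρ i φ)).im = -Ycomp ρ φ i := by
  simp [Ycomp, -WithLp.prod_inner_apply]

/-- This and the next three lemmas are the pointwise algebra of the system: `φ` moves in the
direction `-Ωφ - ½Tφ`. For `N` the operator is `1`, so no rotation term appears. -/
lemma variation_N (ρ : SpinorModule n Δ) {A : Fin n → Fin n → ℝ} (hA : ∀ i j, A i j = -A j i)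
    (c u : Fin n → ℝ) (φ : Spacetime Δ) :
    (inner ℂ φ ((1 : Module.End ℂ (Spacetime Δ))
        (-rotOp ρ A φ - (1 / 2 : ℂ) • killOp ρ c u φ)) +
      inner ℂ (-rotOp ρ A φ - (1 / 2 : ℂ) • killOp ρ c u φ)
        ((1 : Module.End ℂ (Spacetime Δ)) φ)).re =
      -(∑ l, c l * Xcomp ρ φ l) - ∑ l, u l * Ycomp ρ φ l := by
  rw [inner_apply_add_inner_apply (inner_rotOp ρ hA) (inner_killOp ρ c u)]
  have h : (inner ℂ φ (killOp ρ c u φ)).re =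
      (∑ l, c l * Xcomp ρ φ l) + ∑ l, u l * Ycomp ρ φ l := by
    simp [-WithLp.prod_inner_apply, killOp, Xcomp, Ycomp, Finset.mul_sum]
  simp only [one_mul, mul_one, sub_self, LinearMap.zero_apply, inner_zero_right,
    LinearMap.add_apply, inner_add_right]
  simp [-WithLp.prod_inner_apply, h]
  ring

lemma variation_X (ρ : SpinorModule n Δ) {A : Fin n → Fin n → ℝ} (hA : ∀ i j, A i j = -A j i)
    (c u : Fin n → ℝ) (φ : Spacetime Δ) (j : Fin n) :
    (inner ℂ φ ((clOp ρ j * clOp₀ Δ) (-rotOp ρ A φ - (1 / 2 : ℂ) • killOp ρ c u φ)) +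
      inner ℂ (-rotOp ρ A φ - (1 / 2 : ℂ) • killOp ρ c u φ) ((clOp ρ j * clOp₀ Δ) φ)).re =
      ∑ k, A j k * Xcomp ρ φ k - c j * ‖φ‖ ^ 2 + ∑ l, u l * omegaComp ρ φ l j := by
  have hA' : ∀ i j, (A i j : ℂ) = -(A j i : ℂ) := fun i j => by rw [hA]; simp
  rw [inner_apply_add_inner_apply (inner_rotOp ρ hA) (inner_killOp ρ c u), rotOp,
    commutator_rotation_vec (clOp_mul_add_swap ρ) (clOp₀_mul_clOp ρ) hA', killOp,
    anticommutator_vec (clOp_mul_add_swap ρ) (clOp₀_mul_clOp ρ) clOp₀_mul_clOp₀]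
  -- The anticommutator produces the difference `ω_lj - ω_jl`, which is `2 ω_lj` and absorbs the
  -- factor `½`.
  have h : ∀ l, u l * omegaComp ρ φ l j =
      1 / 2 * (u l * (omegaComp ρ φ l j - omegaComp ρ φ j l)) := by
    intro l; rw [omegaComp_antisymm ρ φ j l]; ring
  have hN : (inner ℂ φ φ).re = ‖φ‖ ^ 2 := inner_self_eq_norm_sq (𝕜 := ℂ) φ
  simp only [h, ← Finset.mul_sum]
  simp [-WithLp.prod_inner_apply, -inner_self_eq_norm_sq_to_K, Xcomp, omegaComp,
    Complex.im_sum, hN]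
  ring

lemma variation_Y (ρ : SpinorModule n Δ) {A : Fin n → Fin n → ℝ} (hA : ∀ i j, A i j = -A j i)
    (c u : Fin n → ℝ) (φ : Spacetime Δ) (j : Fin n) :
    (inner ℂ φ ((Complex.I • clOp ρ j) (-rotOp ρ A φ - (1 / 2 : ℂ) • killOp ρ c u φ)) +
      inner ℂ (-rotOp ρ A φ - (1 / 2 : ℂ) • killOp ρ c u φ) ((Complex.I • clOp ρ j) φ)).re =
      ∑ k, A j k * Ycomp ρ φ k - u j * ‖φ‖ ^ 2 + ∑ l, c l * omegaComp ρ φ j l := by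
  have hA' : ∀ i j, (A i j : ℂ) = -(A j i : ℂ) := fun i j => by rw [hA]; simp
  have hrot : rotOp ρ A * (Complex.I • clOp ρ j) - Complex.I • clOp ρ j * rotOp ρ A =
      Complex.I • ∑ k, (A j k : ℂ) • clOp ρ k := by
    rw [rotOp, ← commutator_rotation (clOp_mul_add_swap ρ) hA', mul_smul_comm (Complex.I),
      smul_mul_assoc (Complex.I), smul_sub]
  rw [inner_apply_add_inner_apply (inner_rotOp ρ hA) (inner_killOp ρ c u), hrot, killOp,
    anticommutator_ivec (clOp_mul_add_swap ρ) (clOp₀_mul_clOp ρ)]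
  have h : ∀ l, c l * omegaComp ρ φ j l =
      1 / 2 * (c l * (omegaComp ρ φ j l - omegaComp ρ φ l j)) := by
    intro l; rw [omegaComp_antisymm ρ φ l j]; ring
  have hN : (inner ℂ φ φ).re = ‖φ‖ ^ 2 := inner_self_eq_norm_sq (𝕜 := ℂ) φ
  simp only [h, ← Finset.mul_sum]
  simp [-WithLp.prod_inner_apply, -inner_self_eq_norm_sq_to_K, Ycomp, omegaComp,
    Complex.im_sum, hN]
  ring

lemma variation_omega (ρ : SpinorModule n Δ) {A : Fin n → Fin n → ℝ}
    (hA : ∀ i j, A i j = -A j i) (c u : Fin n → ℝ) (φ : Spacetime Δ) (j k : Fin n) :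
    (inner ℂ φ ((clOp ρ j * (clOp ρ k * clOp₀ Δ))
        (-rotOp ρ A φ - (1 / 2 : ℂ) • killOp ρ c u φ)) +
      inner ℂ (-rotOp ρ A φ - (1 / 2 : ℂ) • killOp ρ c u φ)
        ((clOp ρ j * (clOp ρ k * clOp₀ Δ)) φ)).im =
      ∑ p, A j p * omegaComp ρ φ p k + ∑ p, A k p * omegaComp ρ φ j p +
        (u j * Xcomp ρ φ k - u k * Xcomp ρ φ j - c j * Ycomp ρ φ k + c k * Ycomp ρ φ j) := by
  have hA' : ∀ i j, (A i j : ℂ) = -(A j i : ℂ) := fun i j => by rw [hA]; simp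
  rw [inner_apply_add_inner_apply (inner_rotOp ρ hA) (inner_killOp ρ c u), rotOp,
    commutator_rotation_form (clOp_mul_add_swap ρ) (clOp₀_mul_clOp ρ) hA', killOp,
    anticommutator_form (clOp_mul_add_swap ρ) (clOp₀_mul_clOp ρ) clOp₀_mul_clOp₀]
  have h := im_inner_clOp ρ φ
  simp only [clOp_apply] at h
  simp [-WithLp.prod_inner_apply, -inner_self_eq_norm_sq_to_K, Xcomp, omegaComp,
    Complex.im_sum, h]
  ring

/-! ### Derivatives of functions on manifolds -/

section Calculus

variable {E : Type*} [NormedAddCommGroup E] [NormedSpace ℝ E] {H : Type*} [TopologicalSpace H]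
  {I : ModelWithCorners ℝ E H} {M : Type*} [TopologicalSpace M] [ChartedSpace H M]
  {V W : Type*} [NormedAddCommGroup V] [NormedSpace ℝ V] [NormedAddCommGroup W] [NormedSpace ℝ W]

lemma mdifferentiableAt_comp_of_hasFDerivAt {f : M → V} {x : M}
    (hf : MDifferentiableAt I 𝓘(ℝ, V) f x) {Q : V → W} {Q' : V →L[ℝ] W}
    (hQ : HasFDerivAt Q Q' (f x)) :
    MDifferentiableAt I 𝓘(ℝ, W) (fun y => Q (f y)) x ∧
      ∀ u, mvfderiv I (fun y => Q (f y)) x u = Q' (mvfderiv I f x u) := by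
  have h := hQ.hasMFDerivAt.comp x hf.hasMFDerivAt
  refine ⟨h.mdifferentiableAt, fun u => ?_⟩
  change mfderiv I 𝓘(ℝ, W) (Q ∘ f) x u = _
  rw [h.mfderiv]
  rfl

lemma mvfderiv_congr {f g : M → V} {x : M} (h : f =ᶠ[nhds x] g) :
    mvfderiv I f x = mvfderiv I g x := by
  ext u
  change mfderiv I 𝓘(ℝ, V) f x u = mfderiv I 𝓘(ℝ, V) g x u
  rw [h.mfderiv_eq]
  rfl

lemma mvfderiv_finset_sum {ι : Type*} (s : Finset ι) {f : ι → M → ℝ} {x : M}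
    (hf : ∀ i ∈ s, MDifferentiableAt I 𝓘(ℝ, ℝ) (f i) x) :
    MDifferentiableAt I 𝓘(ℝ, ℝ) (fun y => ∑ i ∈ s, f i y) x ∧
      ∀ u, mvfderiv I (fun y => ∑ i ∈ s, f i y) x u = ∑ i ∈ s, mvfderiv I (f i) x u := by
  classical
  induction s using Finset.induction_on with
  | empty => exact ⟨by simpa using mdifferentiableAt_const, fun u => by simp [mvfderiv_const]⟩
  | insert i s hi ih =>
    obtain ⟨h1, h2⟩ := ih fun j hj => hf j (Finset.mem_insert_of_mem hj)
    have h3 := hf i (Finset.mem_insert_self i s)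
    simp only [Finset.sum_insert hi]
    refine ⟨h3.add h1, fun u => ?_⟩
    rw [mvfderiv_fun_add h3 h1, add_apply, h2]

/-- A function with vanishing derivative on a connected manifold is constant. -/
lemma exists_const_of_mvfderiv_eq_zero [IsManifold I 1 M] [I.Boundaryless] [ConnectedSpace M]
    {f : M → ℝ} (hf : ∀ x, MDifferentiableAt I 𝓘(ℝ, ℝ) f x) (h0 : ∀ x u, mvfderiv I f x u = 0) :
    ∃ c, ∀ x, f x = c := by
  have hlc : IsLocallyConstant f := by
    rw [IsLocallyConstant.iff_eventually_eq]
    intro x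
    -- Without boundary the chart target is open, so it contains a ball around the image of `x`, on
    -- which `f` read in the chart has zero derivative and is therefore constant.
    have ht : IsOpen (extChartAt I x).target := isOpen_extChartAt_target x
    obtain ⟨r, hr, hb⟩ := Metric.isOpen_iff.mp ht _ (mem_extChartAt_target x)
    have hd : ∀ z ∈ Metric.ball (extChartAt I x x) r,
        HasFDerivAt (f ∘ (extChartAt I x).symm) (0 : E →L[ℝ] ℝ) z := by
      intro z hz
      have h1 : MDifferentiableAt 𝓘(ℝ, E) I (extChartAt I x).symm z :=
        ((contMDiffOn_extChartAt_symm (n := 1) x).contMDiffAt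
          (ht.mem_nhds (hb hz))).mdifferentiableAt one_ne_zero
      have h2 := ((hf ((extChartAt I x).symm z)).hasMFDerivAt.comp z h1.hasMFDerivAt).hasFDerivAt
      refine h2.congr_fderiv ?_
      ext v
      exact h0 _ _
    have hc : ∀ z ∈ Metric.ball (extChartAt I x x) r,
        (f ∘ (extChartAt I x).symm) z = (f ∘ (extChartAt I x).symm) (extChartAt I x x) := by
      intro z hz
      exact Metric.isOpen_ball.is_const_of_fderiv_eq_zero
        (convex_ball _ _).isPreconnected
        (fun w hw => (hd w hw).differentiableAt.differentiableWithinAt)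
        (fun w hw => (hd w hw).fderiv) hz (Metric.mem_ball_self hr)
    have hn := (continuousAt_extChartAt (I := I) x).preimage_mem_nhds (Metric.ball_mem_nhds _ hr)
    filter_upwards [hn, extChartAt_source_mem_nhds (I := I) x] with y hy hys
    have := hc _ hy
    rwa [Function.comp_apply, Function.comp_apply, (extChartAt I x).left_inv hys,
      extChartAt_to_inv] at this
  obtain ⟨x₀⟩ := (inferInstance : Nonempty M)
  exact ⟨f x₀, fun x => hlc.apply_eq_of_isPreconnected isPreconnected_univ trivial trivial⟩

end Calculus

/-- With `c` the real or the imaginary part this covers all four bilinears. The map is only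
real-differentiable, being conjugate-linear in one slot; finite dimension makes `A` continuous. -/
lemma hasFDerivAt_inner_apply {V : Type*} [NormedAddCommGroup V] [InnerProductSpace ℂ V]
    [FiniteDimensional ℂ V] (c : ℂ →L[ℝ] ℝ) (A : Module.End ℂ V) (φ : V) :
    ∃ L : V →L[ℝ] ℝ, HasFDerivAt (fun χ => c (inner ℂ χ (A χ))) L φ ∧
      ∀ χ, L χ = c (inner ℂ φ (A χ) + inner ℂ χ (A φ)) := by
  let A' : V →L[ℝ] V := (LinearMap.toContinuousLinearMap A).restrictScalars ℝ
  have h := c.hasFDerivAt.comp φ ((hasFDerivAt_id (𝕜 := ℝ) φ).inner ℂ A'.hasFDerivAt)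
  exact ⟨_, h, fun χ => by simp [A']⟩

section Components

variable {M : Type*} [TopologicalSpace M] [ChartedSpace (EuclideanSpace ℝ (Fin n)) M]
  [FiniteDimensional ℂ Δ]

lemma mvfderiv_inner_apply (c : ℂ →L[ℝ] ℝ) (A : Module.End ℂ (Spacetime Δ))
    {f : M → Spacetime Δ} {x : M} (hf : MDifferentiableAt (model n) 𝓘(ℝ, Spacetime Δ) f x) :
    MDifferentiableAt (model n) 𝓘(ℝ, ℝ) (fun y => c (inner ℂ (f y) (A (f y)))) x ∧
      ∀ u, mvfderiv (model n) (fun y => c (inner ℂ (f y) (A (f y)))) x u =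
        c (inner ℂ (f x) (A (mvfderiv (model n) f x u)) +
          inner ℂ (mvfderiv (model n) f x u) (A (f x))) := by
  obtain ⟨L, hL, hL'⟩ := hasFDerivAt_inner_apply c A (f x)
  obtain ⟨h1, h2⟩ := mdifferentiableAt_comp_of_hasFDerivAt hf hL
  exact ⟨h1, fun u => by rw [h2, hL']⟩

end Components

/-! ### The spinor field and its bilinears in a local frame -/

/-- Linearity in the coefficients, here and in `killOp_sum`, extends the Killing equation from frame
directions to an arbitrary direction. -/
lemma rotOp_sum (ρ : SpinorModule n Δ) {ι : Type*} (s : Finset ι) (t : ι → ℝ)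
    (A : ι → Fin n → Fin n → ℝ) :
    rotOp ρ (fun p q => ∑ i ∈ s, t i * A i p q) = ∑ i ∈ s, (t i : ℂ) • rotOp ρ (A i) := by
  simp only [rotOp, Complex.ofReal_sum, Complex.ofReal_mul, Finset.sum_smul]
  simp only [Finset.smul_sum, Finset.sum_comm (t := s)]
  refine Finset.sum_congr rfl fun p _ => Finset.sum_congr rfl fun q _ =>
    Finset.sum_congr rfl fun i _ => ?_
  module

lemma killOp_sum (ρ : SpinorModule n Δ) {ι : Type*} (s : Finset ι) (t : ι → ℝ)
    (c u : ι → Fin n → ℝ) :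
    killOp ρ (fun l => ∑ i ∈ s, t i * c i l) (fun l => ∑ i ∈ s, t i * u i l) =
      ∑ i ∈ s, (t i : ℂ) • killOp ρ (c i) (u i) := by
  simp only [killOp, Complex.ofReal_sum, Complex.ofReal_mul, Finset.sum_smul, smul_add,
    Finset.sum_add_distrib]
  simp only [Finset.sum_mul, Finset.smul_sum, Finset.sum_comm (t := s)]
  congr 1 <;> refine Finset.sum_congr rfl fun l _ => Finset.sum_congr rfl fun i _ => ?_
  · simp only [mul_smul, smul_mul_assoc]
  · module

section Frame

variable {M : Type*} [TopologicalSpace M] [ChartedSpace (EuclideanSpace ℝ (Fin n)) M]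
  [IsManifold (model n) ∞ M]
  [RiemannianBundle (fun x : M => TangentSpace (model n) x)]
  {κ : Type*}

lemma SpinStructure.mdifferentiableAt_frame (S : SpinStructure n M κ) {a : κ} {x : M}
    (hx : x ∈ S.U a) (i : Fin n) :
    MDifferentiableAt (model n) ((model n).prod 𝓘(ℝ, EuclideanSpace ℝ (Fin n)))
      (T% (S.frame a i)) x :=
  ((S.frame_contMDiffOn a i).contMDiffAt ((S.isOpen a).mem_nhds hx)).mdifferentiableAt one_ne_zero

lemma SpinorField.mdifferentiableAt_rep {S : SpinStructure n M κ} {ρ : SpinorModule n Δ}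
    (ψ : SpinorField S ρ) {a : κ} {x : M} (hx : x ∈ S.U a) :
    MDifferentiableAt (model n) 𝓘(ℝ, Spacetime Δ) (ψ.rep a) x :=
  ((ψ.contMDiffOn a).contMDiffAt ((S.isOpen a).mem_nhds hx)).mdifferentiableAt one_ne_zero

lemma SpinStructure.inner_frame (S : SpinStructure n M κ) {a : κ} {x : M} (hx : x ∈ S.U a)
    (i j : Fin n) : inner ℝ (S.frame a i x) (S.frame a j x) = if i = j then (1 : ℝ) else 0 :=
  orthonormal_iff_ite.mp (S.frame_orthonormal a x hx) i j

lemma SpinStructure.sum_inner_mul_inner (S : SpinStructure n M κ) {a : κ} {x : M}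
    (hx : x ∈ S.U a) (v w : TangentSpace (model n) x) :
    ∑ i, inner ℝ v (S.frame a i x) * inner ℝ w (S.frame a i x) = (inner ℝ v w : ℝ) := by
  conv_rhs => rw [← S.sum_frame hx w, inner_sum]
  refine Finset.sum_congr rfl fun i _ => ?_
  rw [inner_smul_right, mul_comm]

lemma SpinStructure.sum_clm_frame (S : SpinStructure n M κ) {a : κ} {x : M}
    (hx : x ∈ S.U a) (L : TangentSpace (model n) x →L[ℝ] ℝ) (v : TangentSpace (model n) x) :
    ∑ i, inner ℝ v (S.frame a i x) * L (S.frame a i x) = L v := by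
  conv_rhs => rw [← S.sum_frame hx v, map_sum]
  simp only [map_smul, smul_eq_mul]

/-- The connection coefficients `⟨D_u e_p, e_q⟩` of a local frame. -/
def connCoeff (D : CovariantDerivative (model n) (EuclideanSpace ℝ (Fin n))
      (fun x : M => TangentSpace (model n) x)) (S : SpinStructure n M κ) (a : κ) (x : M)
    (u : TangentSpace (model n) x) (p q : Fin n) : ℝ :=
  inner ℝ (D (S.frame a p) x u) (S.frame a q x)

variable {D : CovariantDerivative (model n) (EuclideanSpace ℝ (Fin n))
      (fun x : M => TangentSpace (model n) x)}

/-- Differentiate the locally constant function `⟨e_p, e_q⟩ = δ_pq` with a metric connection. -/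
lemma connCoeff_antisymm [IsContMDiffRiemannianBundle (model n) 1 (EuclideanSpace ℝ (Fin n))
      (fun x : M => TangentSpace (model n) x)] (hD : IsLeviCivita D)
    (S : SpinStructure n M κ) {a : κ} {x : M} (hx : x ∈ S.U a) (u : TangentSpace (model n) x)
    (p q : Fin n) : connCoeff D S a x u p q = -connCoeff D S a x u q p := by
  -- Metric compatibility is applied along a vector field, so `u` is extended to one with value `u`
  -- at `x`.
  have h := hD.metric.mvfderiv_inner_eq (x := x)
    (FiberBundle.extend (EuclideanSpace ℝ (Fin n)) u) (S.mdifferentiableAt_frame hx p)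
    (S.mdifferentiableAt_frame hx q)
  have hc : (fun y => (inner ℝ (S.frame a p y) (S.frame a q y) : ℝ)) =ᶠ[nhds x]
      fun _ => if p = q then 1 else 0 := by
    filter_upwards [(S.isOpen a).mem_nhds hx] with y hy using S.inner_frame hy p q
  rw [mvfderiv_congr hc, mvfderiv_const] at h
  simp only [FiberBundle.extend_apply_self, zero_apply] at h
  rw [connCoeff, connCoeff, real_inner_comm _ (D (S.frame a q) x u)]
  linarith

/-- The Killing equation solved for the plain derivative. It is given on frame vectors only; both
sides are linear in `u`. -/
lemma SpinorField.mvfderiv_rep {S : SpinStructure n M κ} {ρ : SpinorModule n Δ}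
    {ψ : SpinorField S ρ} {k : (x : M) → TangentSpace (model n) x →L[ℝ]
      TangentSpace (model n) x →L[ℝ] ℝ} (hψ : IsKilling D k ψ) {a : κ} {x : M}
    (hx : x ∈ S.U a) (u : TangentSpace (model n) x) :
    mvfderiv (model n) (ψ.rep a) x u =
      -rotOp ρ (connCoeff D S a x u) (ψ.rep a x) - (1 / 2 : ℂ) •
        killOp ρ (fun l => k x u (S.frame a l x)) (fun l => inner ℝ u (S.frame a l x))
          (ψ.rep a x) := by
  have hbasis : ∀ i, mvfderiv (model n) (ψ.rep a) x (S.frame a i x) =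
      -rotOp ρ (connCoeff D S a x (S.frame a i x)) (ψ.rep a x) - (1 / 2 : ℂ) •
        killOp ρ (fun l => k x (S.frame a i x) (S.frame a l x))
          (fun l => inner ℝ (S.frame a i x) (S.frame a l x)) (ψ.rep a x) := by
    intro i
    have h := hψ a x hx i
    rw [spinConn, ← eq_sub_iff_add_eq] at h
    rw [h]
    -- For `u = e_i` the coefficients `⟨e_i, e_l⟩` are Kronecker deltas, so the sum `u_l e_l`
    -- collapses to `e_i`.
    simp only [killOp, rotOp, S.inner_frame hx, connCoeff]
    simp only [LinearMap.smul_apply, LinearMap.add_apply, LinearMap.sum_apply,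
      Module.End.mul_apply, clOp_apply, clOp₀_apply, Complex.ofReal_one, Complex.ofReal_zero,
      apply_ite Complex.ofReal, ite_smul, one_smul, zero_smul, Finset.sum_ite_eq, Finset.mem_univ,
      if_true, Complex.coe_smul]
    rw [← Complex.coe_smul (1 / 4 : ℝ), ← Complex.coe_smul (1 / 2 : ℝ),
      ← Complex.coe_smul (1 / 2 : ℝ)]
    push_cast
    module
  have hconn : connCoeff D S a x u = fun p q => ∑ i, inner ℝ u (S.frame a i x) *
      connCoeff D S a x (S.frame a i x) p q := by
    funext p q
    have := S.sum_clm_frame hx ((innerSL ℝ (S.frame a q x)).comp (D (S.frame a p) x)) u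
    simpa [connCoeff, real_inner_comm] using this.symm
  have hk : (fun l => k x u (S.frame a l x)) = fun l => ∑ i, inner ℝ u (S.frame a i x) *
      k x (S.frame a i x) (S.frame a l x) := by
    funext l
    have := S.sum_clm_frame hx ((ContinuousLinearMap.flip (k x)) (S.frame a l x)) u
    simpa using this.symm
  have hu : (fun l => (inner ℝ u (S.frame a l x) : ℝ)) = fun l =>
      ∑ i, inner ℝ u (S.frame a i x) * inner ℝ (S.frame a i x) (S.frame a l x) := by
    funext l
    simp [S.inner_frame hx]
  rw [hconn, hk, hu, rotOp_sum, killOp_sum]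
  conv_lhs => rw [← S.sum_frame hx u, map_sum]
  simp only [map_smul, hbasis, LinearMap.sum_apply, LinearMap.smul_apply, ← Complex.coe_smul,
    Finset.smul_sum, ← Finset.sum_neg_distrib, ← Finset.sum_sub_distrib]
  refine Finset.sum_congr rfl fun i _ => ?_
  module

end Frame

/-! ### Index identities -/

lemma sum_antisymm_mul_eq_zero {A : Fin n → Fin n → ℝ} (hA : ∀ i j, A i j = -A j i)
    (X : Fin n → ℝ) : ∑ j, X j * ∑ k, A j k * X k = 0 := by
  have h : ∑ j, ∑ k, X j * (A j k * X k) = -∑ j, ∑ k, X j * (A j k * X k) := by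
    conv_lhs => rw [Finset.sum_comm]
    simp only [← Finset.sum_neg_distrib]
    refine Finset.sum_congr rfl fun j _ => Finset.sum_congr rfl fun k _ => ?_
    rw [hA k j]; ring
  simp only [Finset.mul_sum]
  linarith

lemma sum_mul_antisymm_mul_eq_zero {A : Fin n → Fin n → ℝ} (hA : ∀ i j, A i j = -A j i)
    (W : Fin n → Fin n → ℝ) : ∑ j, ∑ k, W j k * ∑ p, A j p * W p k = 0 := by
  rw [Finset.sum_comm]
  exact Finset.sum_eq_zero fun k _ => sum_antisymm_mul_eq_zero hA fun j => W j k

lemma sum_swap_antisymm {W : Fin n → Fin n → ℝ} (hW : ∀ i j, W i j = -W j i)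
    (a b : Fin n → ℝ) : ∑ j, ∑ k, W j k * (a k * b j) = -∑ j, ∑ k, W j k * (a j * b k) := by
  rw [Finset.sum_comm]
  simp only [← Finset.sum_neg_distrib]
  refine Finset.sum_congr rfl fun j _ => Finset.sum_congr rfl fun k _ => ?_
  rw [hW k j]; ring

/-- The derivative of `N² - |X|² - |Y|² + ½|ω|²` vanishes. -/
lemma conserved_identity {A W : Fin n → Fin n → ℝ} (hA : ∀ i j, A i j = -A j i)
    (hW : ∀ i j, W i j = -W j i) (N : ℝ) (X Y c t : Fin n → ℝ) :
    2 * (N * (-(∑ l, c l * X l) - ∑ l, t l * Y l)) -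
      ∑ j, 2 * (X j * (∑ k, A j k * X k - c j * N + ∑ l, t l * W l j)) -
      ∑ j, 2 * (Y j * (∑ k, A j k * Y k - t j * N + ∑ l, c l * W j l)) +
      1 / 2 * ∑ j, ∑ k, 2 * (W j k * (∑ p, A j p * W p k + ∑ p, A k p * W j p +
        (t j * X k - t k * X j - c j * Y k + c k * Y j))) = 0 := by
  -- The `a` identities remove all connection terms.
  have a1 := sum_antisymm_mul_eq_zero hA X
  have a2 := sum_antisymm_mul_eq_zero hA Y
  have a3 := sum_mul_antisymm_mul_eq_zero hA W
  have a4 : ∑ j, ∑ k, W j k * ∑ p, A k p * W j p = 0 :=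
    Finset.sum_eq_zero fun j _ => sum_antisymm_mul_eq_zero hA fun k => W j k
  -- The four terms of `dω` contracted with `W` pair up into twice two of them; after the factor `½`
  -- these cancel the `ω` terms of `d|X|²` and `d|Y|²`.
  have b1 := sum_swap_antisymm hW t X
  have b2 := sum_swap_antisymm hW c Y
  have b3 : ∑ j, X j * ∑ l, t l * W l j = ∑ j, ∑ k, W j k * (t j * X k) := by
    simp only [Finset.mul_sum]
    rw [Finset.sum_comm]
    exact Finset.sum_congr rfl fun j _ => Finset.sum_congr rfl fun k _ => by ring
  have b4 : ∑ j, Y j * ∑ l, c l * W j l = ∑ j, ∑ k, W j k * (c k * Y j) := by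
    simp only [Finset.mul_sum]
    exact Finset.sum_congr rfl fun j _ => Finset.sum_congr rfl fun k _ => by ring
  -- The terms carrying `N` in `d|X|²` and `d|Y|²` cancel `d(N²)`.
  have c1 : ∑ j, X j * (c j * N) = N * ∑ l, c l * X l := by
    rw [Finset.mul_sum]; exact Finset.sum_congr rfl fun j _ => by ring
  have c2 : ∑ j, Y j * (t j * N) = N * ∑ l, t l * Y l := by
    rw [Finset.mul_sum]; exact Finset.sum_congr rfl fun j _ => by ring
  simp only [← Finset.mul_sum, mul_add, mul_sub, Finset.sum_add_distrib, Finset.sum_sub_distrib,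
    a1, a2, a3, a4, b1, b2, b3, b4, c1, c2]
  ring

/-! ### Invariance under change of orthonormal frame -/

/-- Both sides are the squared norm of `∑ b_q f_q`: by Parseval in `e`, and by orthonormality of
`f`. -/
lemma sum_sq_sum_mul_inner {V : Type*} [NormedAddCommGroup V]
    [InnerProductSpace ℝ V] {ι : Type*} [Fintype ι] (e : OrthonormalBasis ι ℝ V)
    {f : Fin n → V} (hf : Orthonormal ℝ f) (b : Fin n → ℝ) :
    ∑ j, (∑ q, b q * inner ℝ (f q) (e j)) ^ 2 = ∑ q, b q ^ 2 := by
  have h1 : ∀ j, ∑ q, b q * inner ℝ (f q) (e j) = inner ℝ (∑ q, b q • f q) (e j) := fun j => by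
    simp [sum_inner, inner_smul_left]
  have h2 : ∑ j, (inner ℝ (∑ q, b q • f q) (e j) : ℝ) ^ 2 = ‖∑ q, b q • f q‖ ^ 2 := by
    rw [← e.sum_sq_norm_inner_left (∑ q, b q • f q)]
    simp
  simp only [h1, h2]
  rw [← real_inner_self_eq_norm_sq, hf.inner_sum]
  simp [pow_two]

/-! ### Leibniz rule for finite combinations of vector fields. -/

section Sums

variable {M : Type*} [TopologicalSpace M] [ChartedSpace (EuclideanSpace ℝ (Fin n)) M]
  [IsManifold (model n) ∞ M]

lemma covariantDerivative_sum_smul (D : CovariantDerivative (model n) (EuclideanSpace ℝ (Fin n))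
      (fun x : M => TangentSpace (model n) x)) {ι : Type*} (s : Finset ι) {f : ι → M → ℝ}
    {e : ι → (x : M) → TangentSpace (model n) x} {x : M}
    (hf : ∀ i, MDifferentiableAt (model n) 𝓘(ℝ, ℝ) (f i) x)
    (he : ∀ i, MDifferentiableAt (model n)
      ((model n).prod 𝓘(ℝ, EuclideanSpace ℝ (Fin n))) (T% (e i)) x) :
    MDifferentiableAt (model n) ((model n).prod 𝓘(ℝ, EuclideanSpace ℝ (Fin n)))
        (T% (∑ i ∈ s, f i • e i)) x ∧
      ∀ u, D (∑ i ∈ s, f i • e i) x u =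
        ∑ i ∈ s, (f i x • D (e i) x u + mvfderiv (model n) (f i) x u • e i x) := by
  classical
  induction s using Finset.induction_on with
  | empty =>
    simp only [Finset.sum_empty]
    exact ⟨mdifferentiableAt_zeroSection .., fun u => by rw [D.zero]; rfl⟩
  | insert i s hi ih =>
    have h3 := (hf i).smul_section (he i)
    simp only [Finset.sum_insert hi]
    refine ⟨mdifferentiableAt_add_section h3 ih.1, fun u => ?_⟩
    rw [D.isCovariantDerivativeOn.add (s := Set.univ) h3 ih.1,
      D.isCovariantDerivativeOn.leibniz (s := Set.univ) (he i) (hf i), add_apply, ih.2]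
    rfl

end Sums

/-! ### Passing between orthonormal bases and the frames of the spin structure. -/

section Fields

variable {M : Type*} [TopologicalSpace M] [ChartedSpace (EuclideanSpace ℝ (Fin n)) M]
  [IsManifold (model n) ∞ M]
  [RiemannianBundle (fun x : M => TangentSpace (model n) x)]
  {κ : Type*} {S : SpinStructure n M κ} {ρ : SpinorModule n Δ}

lemma SpinStructure.exists_orthonormalBasis (S : SpinStructure n M κ) (x : M) :
    Nonempty (OrthonormalBasis (Fin n) ℝ (TangentSpace (model n) x)) := by
  have hcard : Fintype.card (Fin n) = Module.finrank ℝ (TangentSpace (model n) x) := by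
    have : Module.finrank ℝ (TangentSpace (model n) x) =
      Module.finrank ℝ (EuclideanSpace ℝ (Fin n)) := rfl
    rw [this]; simp
  have : FiniteDimensional ℝ (TangentSpace (model n) x) :=
    inferInstanceAs (FiniteDimensional ℝ (EuclideanSpace ℝ (Fin n)))
  obtain ⟨a, hx⟩ := S.cover x
  have ho := S.frame_orthonormal a x hx
  exact ⟨OrthonormalBasis.mk ho
    (ho.linearIndependent.span_eq_top_of_card_eq_finrank' hcard).ge⟩

/-- Parseval is applied in one slot of `ω` and then in the other. -/
lemma SpinorField.sum_sq_omega (ψ : SpinorField S ρ) {a : κ} {x : M} (hx : x ∈ S.U a)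
    (e : OrthonormalBasis (Fin n) ℝ (TangentSpace (model n) x)) :
    ∑ i, ∑ j, ψ.omega x (e i) (e j) ^ 2 = ∑ p, ∑ q, omegaComp ρ (ψ.rep a x) p q ^ 2 := by
  have hf := S.frame_orthonormal a x hx
  have h1 : ∀ i j, ψ.omega x (e i) (e j) = ∑ q, (∑ p, omegaComp ρ (ψ.rep a x) p q *
      inner ℝ (S.frame a p x) (e i)) * inner ℝ (S.frame a q x) (e j) := by
    intro i j
    rw [ψ.omega_eq hx, Finset.sum_comm]
    simp only [Finset.sum_mul]
  simp only [h1, sum_sq_sum_mul_inner e hf]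
  rw [Finset.sum_comm]
  simp only [sum_sq_sum_mul_inner e hf]
  rw [Finset.sum_comm]

/-- A contraction does not depend on the orthonormal basis: summing `L(e_l) ⟨f_j, e_l⟩` over `l`
gives `L(f_j)` for each frame vector `f_j`. -/
lemma SpinorField.sum_clm_mul_omega (ψ : SpinorField S ρ) {a : κ} {x : M} (hx : x ∈ S.U a)
    (L : TangentSpace (model n) x →L[ℝ] ℝ) (v : TangentSpace (model n) x)
    (e : OrthonormalBasis (Fin n) ℝ (TangentSpace (model n) x)) :
    ∑ l, L (e l) * ψ.omega x v (e l) = ∑ j, inner ℝ v (S.frame a j x) *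
      ∑ l, L (S.frame a l x) * omegaComp ρ (ψ.rep a x) j l := by
  have hL : ∀ w, L w = ∑ l, inner ℝ w (e l) * L (e l) := by
    intro w
    conv_lhs => rw [← e.sum_repr' w, map_sum]
    simp [real_inner_comm]
  simp only [ψ.omega_eq hx, hL (S.frame a _ x), Finset.mul_sum, Finset.sum_mul]
  rw [Finset.sum_comm]
  refine Finset.sum_congr rfl fun i _ => ?_
  rw [Finset.sum_comm]
  refine Finset.sum_congr rfl fun j _ => Finset.sum_congr rfl fun l _ => ?_
  rw [real_inner_comm v]
  ring

lemma SpinStructure.norm_sq_sum_frame (S : SpinStructure n M κ) {a : κ} {x : M} (hx : x ∈ S.U a)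
    (b : Fin n → ℝ) : ‖∑ i, b i • S.frame a i x‖ ^ 2 = ∑ i, b i ^ 2 := by
  rw [← real_inner_self_eq_norm_sq, (S.frame_orthonormal a x hx).inner_sum]
  simp [pow_two]

/-! ### Covariant derivatives of fields given by components -/

variable [IsContMDiffRiemannianBundle (model n) 1 (EuclideanSpace ℝ (Fin n))
      (fun x : M => TangentSpace (model n) x)]
  {D : CovariantDerivative (model n) (EuclideanSpace ℝ (Fin n))
      (fun x : M => TangentSpace (model n) x)}

/-- The covariant derivative of a vector field from its components in a local frame. -/
lemma covariantDerivative_of_components (hD : IsLeviCivita D)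
    {Z : (x : M) → TangentSpace (model n) x} {f : Fin n → M → ℝ} {a : κ} {x : M} (hx : x ∈ S.U a)
    (hZ : ∀ y ∈ S.U a, Z y = ∑ i, f i y • S.frame a i y)
    (hf : ∀ i, MDifferentiableAt (model n) 𝓘(ℝ, ℝ) (f i) x) :
    MDifferentiableAt (model n) ((model n).prod 𝓘(ℝ, EuclideanSpace ℝ (Fin n))) (T% Z) x ∧
      ∀ u v, inner ℝ (D Z x u) v = ∑ j, inner ℝ v (S.frame a j x) *
        (mvfderiv (model n) (f j) x u - ∑ k, connCoeff D S a x u j k * f k x) := by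
  obtain ⟨h1, h2⟩ := covariantDerivative_sum_smul D Finset.univ hf
    (S.mdifferentiableAt_frame hx)
  have hev : ∀ᶠ y in nhds x, Z y = (∑ i, f i • S.frame a i) y := by
    filter_upwards [(S.isOpen a).mem_nhds hx] with y hy
    rw [hZ y hy, Finset.sum_apply]
    rfl
  have hZd : MDifferentiableAt (model n) ((model n).prod 𝓘(ℝ, EuclideanSpace ℝ (Fin n)))
      (T% Z) x := h1.congr_of_eventuallyEq (hev.mono fun y hy => by simp only [hy])
  refine ⟨hZd, fun u v => ?_⟩
  -- `D` is local, so `Z` may be replaced by its frame expansion, valid only near `x`.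
  rw [D.isCovariantDerivativeOnUniv.congr_of_eventuallyEq hZd h1 Filter.univ_mem hev, h2, sum_inner]
  have hDe : ∀ i, inner ℝ (D (S.frame a i) x u) v =
      ∑ j, inner ℝ v (S.frame a j x) * connCoeff D S a x u i j := fun i => by
    rw [← S.sum_inner_mul_inner hx]
    exact Finset.sum_congr rfl fun j _ => mul_comm _ _
  simp only [inner_add_left, inner_smul_left, hDe, Finset.sum_add_distrib, mul_sub,
    Finset.sum_sub_distrib, Finset.mul_sum, RCLike.conj_to_real]
  rw [Finset.sum_comm, add_comm, sub_eq_add_neg, ← Finset.sum_neg_distrib]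
  congr 1
  · exact Finset.sum_congr rfl fun j _ => by rw [real_inner_comm, mul_comm]
  · refine Finset.sum_congr rfl fun j _ => ?_
    rw [← Finset.sum_neg_distrib]
    refine Finset.sum_congr rfl fun i _ => ?_
    -- The Leibniz rule gives `+A_ij f_i`; antisymmetry turns it into the `-A_ji f_i` that cancels
    -- the rotation term in the derivative of the components.
    rw [connCoeff_antisymm hD S hx u j i]
    ring

end Fields

/-! ### Products of functions on manifolds -/

section Products

variable {E : Type*} [NormedAddCommGroup E] [NormedSpace ℝ E] {H : Type*} [TopologicalSpace H]
  {I : ModelWithCorners ℝ E H} {M : Type*} [TopologicalSpace M] [ChartedSpace H M]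
  {f g h : M → ℝ} {x : M}

lemma mvfderiv_mul_mul (hf : MDifferentiableAt I 𝓘(ℝ, ℝ) f x)
    (hg : MDifferentiableAt I 𝓘(ℝ, ℝ) g x) (hh : MDifferentiableAt I 𝓘(ℝ, ℝ) h x) :
    MDifferentiableAt I 𝓘(ℝ, ℝ) (fun y => f y * g y * h y) x ∧
      ∀ u, mvfderiv I (fun y => f y * g y * h y) x u =
        mvfderiv I f x u * g x * h x + f x * mvfderiv I g x u * h x +
          f x * g x * mvfderiv I h x u := by
  have hfg : MDifferentiableAt I 𝓘(ℝ, ℝ) (fun y => f y * g y) x := hf.mul hg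
  refine ⟨hfg.mul hh, fun u => ?_⟩
  rw [mvfderiv_fun_mul hfg hh, add_apply, smul_apply, smul_apply, mvfderiv_fun_mul hf hg,
    add_apply, smul_apply, smul_apply]
  simp only [smul_eq_mul]
  ring

lemma mvfderiv_sq (hf : MDifferentiableAt I 𝓘(ℝ, ℝ) f x) :
    MDifferentiableAt I 𝓘(ℝ, ℝ) (fun y => f y ^ 2) x ∧
      ∀ u, mvfderiv I (fun y => f y ^ 2) x u = 2 * (f x * mvfderiv I f x u) := by
  simp only [pow_two]
  refine ⟨hf.mul hf, fun u => ?_⟩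
  rw [mvfderiv_fun_mul hf hf, add_apply, smul_apply, smul_eq_mul]
  ring

end Products

/-! ### Index identities for the covariant derivative of a two-form -/

lemma sum_antisymm_duality {A : Fin n → Fin n → ℝ} (hA : ∀ i j, A i j = -A j i)
    (b v : Fin n → ℝ) :
    ∑ i, (∑ p, A i p * b p) * v i + ∑ i, b i * (∑ p, A i p * v p) = 0 := by
  simp only [Finset.sum_mul, Finset.mul_sum]
  rw [Finset.sum_comm, ← Finset.sum_add_distrib]
  refine Finset.sum_eq_zero fun i _ => ?_
  rw [← Finset.sum_add_distrib]
  refine Finset.sum_eq_zero fun p _ => ?_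
  rw [hA p i]; ring

/-- In the product rule for `ω_ij V_i W_j`, the rotation of the components of `ω` cancels that of
the components of `V` and `W`. What remains is the true covariant derivative `R` and the terms with
`v'`, `w'`, the components of `∇V`, `∇W`. -/
lemma sum_two_form_derivative {A : Fin n → Fin n → ℝ} (hA : ∀ i j, A i j = -A j i)
    (W R : Fin n → Fin n → ℝ) (v w v' w' : Fin n → ℝ) :
    ∑ i, ∑ j, ((∑ p, A i p * W p j + ∑ p, A j p * W i p + R i j) * v i * w j +
      W i j * (∑ p, A i p * v p + v' i) * w j + W i j * v i * (∑ p, A j p * w p + w' j)) =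
      ∑ i, ∑ j, R i j * v i * w j + ∑ i, ∑ j, W i j * v' i * w j +
        ∑ i, ∑ j, W i j * v i * w' j := by
  have h1 : ∑ i, ∑ j, ((∑ p, A i p * W p j) * v i * w j + W i j * (∑ p, A i p * v p) * w j) =
      0 := by
    rw [Finset.sum_comm]
    refine Finset.sum_eq_zero fun j _ => ?_
    simp only [← add_mul, ← Finset.sum_mul]
    rw [Finset.sum_add_distrib, sum_antisymm_duality hA (fun i => W i j) v, zero_mul]
  have h2 : ∑ i, ∑ j, ((∑ p, A j p * W i p) * v i * w j + W i j * v i * (∑ p, A j p * w p)) =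
      0 := by
    refine Finset.sum_eq_zero fun i _ => ?_
    rw [← mul_zero (v i), ← sum_antisymm_duality hA (W i) w, ← Finset.sum_add_distrib,
      Finset.mul_sum]
    exact Finset.sum_congr rfl fun j _ => by ring
  simp only [add_mul, mul_add, Finset.sum_add_distrib] at h1 h2 ⊢
  linarith

lemma sum_wedge (t X c Y v w : Fin n → ℝ) :
    ∑ i, ∑ j, (t i * X j - t j * X i - c i * Y j + c j * Y i) * v i * w j =
      (∑ i, t i * v i) * (∑ j, w j * X j) - (∑ j, t j * w j) * (∑ i, v i * X i) -
        (∑ i, v i * c i) * (∑ j, w j * Y j) + (∑ j, w j * c j) * (∑ i, v i * Y i) := by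
  rw [mul_comm (∑ j, t j * w j), mul_comm (∑ j, w j * c j)]
  simp only [Finset.sum_mul_sum, ← Finset.sum_add_distrib, ← Finset.sum_sub_distrib]
  exact Finset.sum_congr rfl fun i _ => Finset.sum_congr rfl fun j _ => by ring

/-! ### Pairings with `X` and `Y`, and the invariant, in frame components. -/

section LocalForms

variable {M : Type*} [TopologicalSpace M] [ChartedSpace (EuclideanSpace ℝ (Fin n)) M]
  [IsManifold (model n) ∞ M]
  [RiemannianBundle (fun x : M => TangentSpace (model n) x)]
  {κ : Type*} {S : SpinStructure n M κ} {ρ : SpinorModule n Δ}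

namespace SpinorField

lemma inner_X (ψ : SpinorField S ρ) {a : κ} {x : M} (hx : x ∈ S.U a)
    (v : TangentSpace (model n) x) :
    inner ℝ (ψ.X x) v = ∑ l, inner ℝ v (S.frame a l x) * Xcomp ρ (ψ.rep a x) l := by
  rw [ψ.X_eq hx, sum_inner]
  refine Finset.sum_congr rfl fun l _ => ?_
  rw [real_inner_smul_left, real_inner_comm, mul_comm]

lemma inner_Y (ψ : SpinorField S ρ) {a : κ} {x : M} (hx : x ∈ S.U a)
    (v : TangentSpace (model n) x) :
    inner ℝ (ψ.Y x) v = ∑ l, inner ℝ v (S.frame a l x) * Ycomp ρ (ψ.rep a x) l := by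
  rw [ψ.Y_eq hx, sum_inner]
  refine Finset.sum_congr rfl fun l _ => ?_
  rw [real_inner_smul_left, real_inner_comm, mul_comm]

/-- The function `N² - |X|² - |Y|² + ½|ω|²` in a local frame. -/
def localInvariant (ψ : SpinorField S ρ) (a : κ) (x : M) : ℝ :=
  ψ.N x ^ 2 - ∑ j, Xcomp ρ (ψ.rep a x) j ^ 2 - ∑ j, Ycomp ρ (ψ.rep a x) j ^ 2 +
    1 / 2 * ∑ i, ∑ j, omegaComp ρ (ψ.rep a x) i j ^ 2

lemma localInvariant_eq (ψ : SpinorField S ρ) {a : κ} {x : M} (hx : x ∈ S.U a)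
    (e : OrthonormalBasis (Fin n) ℝ (TangentSpace (model n) x)) :
    ψ.N x ^ 2 - ‖ψ.X x‖ ^ 2 - ‖ψ.Y x‖ ^ 2 + 1 / 2 * ∑ i, ∑ j, ψ.omega x (e i) (e j) ^ 2 =
      ψ.localInvariant a x := by
  rw [ψ.sum_sq_omega hx, ψ.X_eq hx, ψ.Y_eq hx, S.norm_sq_sum_frame hx, S.norm_sq_sum_frame hx,
    localInvariant]

end SpinorField

end LocalForms

/-! ### The first-order system for the bilinears of a Killing spinor -/

section System

variable {M : Type*} [TopologicalSpace M] [ChartedSpace (EuclideanSpace ℝ (Fin n)) M]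
  [IsManifold (model n) ∞ M]
  [RiemannianBundle (fun x : M => TangentSpace (model n) x)]
  [IsContMDiffRiemannianBundle (model n) 1 (EuclideanSpace ℝ (Fin n))
      (fun x : M => TangentSpace (model n) x)]
  {D : CovariantDerivative (model n) (EuclideanSpace ℝ (Fin n))
      (fun x : M => TangentSpace (model n) x)}
  {κ : Type*} {S : SpinStructure n M κ} [FiniteDimensional ℂ Δ] {ρ : SpinorModule n Δ}
  {ψ : SpinorField S ρ} {k : (x : M) → TangentSpace (model n) x →L[ℝ]
      TangentSpace (model n) x →L[ℝ] ℝ}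

namespace SpinorField

lemma mvfderiv_N (hD : IsLeviCivita D) (hψ : IsKilling D k ψ) {a : κ} {x : M} (hx : x ∈ S.U a) :
    MDifferentiableAt (model n) 𝓘(ℝ, ℝ) ψ.N x ∧ ∀ u, mvfderiv (model n) ψ.N x u =
      -(∑ l, k x u (S.frame a l x) * Xcomp ρ (ψ.rep a x) l) -
        ∑ l, inner ℝ u (S.frame a l x) * Ycomp ρ (ψ.rep a x) l := by
  obtain ⟨h1, h2⟩ := mvfderiv_inner_apply Complex.reCLM 1 (ψ.mdifferentiableAt_rep hx)
  -- The index chosen in the definition of `N` may vary from point to point; near `x` one fixed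
  -- frame is used instead.
  have hev : ψ.N =ᶠ[nhds x] fun y => Complex.reCLM
      (inner ℂ (ψ.rep a y) ((1 : Module.End ℂ (Spacetime Δ)) (ψ.rep a y))) := by
    filter_upwards [(S.isOpen a).mem_nhds hx] with y hy
    rw [ψ.N_eq hy]
    exact (inner_self_eq_norm_sq (𝕜 := ℂ) (ψ.rep a y)).symm
  refine ⟨h1.congr_of_eventuallyEq hev, fun u => ?_⟩
  rw [mvfderiv_congr hev, h2, mvfderiv_rep hψ hx]
  exact variation_N ρ (connCoeff_antisymm hD S hx u) _ _ _

lemma mvfderiv_Xcomp (hD : IsLeviCivita D) (hψ : IsKilling D k ψ) {a : κ} {x : M}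
    (hx : x ∈ S.U a) (j : Fin n) :
    MDifferentiableAt (model n) 𝓘(ℝ, ℝ) (fun y => Xcomp ρ (ψ.rep a y) j) x ∧
      ∀ u, mvfderiv (model n) (fun y => Xcomp ρ (ψ.rep a y) j) x u =
        ∑ i, connCoeff D S a x u j i * Xcomp ρ (ψ.rep a x) i - k x u (S.frame a j x) * ψ.N x +
          ∑ l, inner ℝ u (S.frame a l x) * omegaComp ρ (ψ.rep a x) l j := by
  obtain ⟨h1, h2⟩ := mvfderiv_inner_apply Complex.reCLM (clOp ρ j * clOp₀ Δ)
    (ψ.mdifferentiableAt_rep hx)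
  refine ⟨h1, fun u => (h2 u).trans ?_⟩
  rw [mvfderiv_rep hψ hx, ψ.N_eq hx]
  exact variation_X ρ (connCoeff_antisymm hD S hx u) _ _ _ j

lemma mvfderiv_Ycomp (hD : IsLeviCivita D) (hψ : IsKilling D k ψ) {a : κ} {x : M}
    (hx : x ∈ S.U a) (j : Fin n) :
    MDifferentiableAt (model n) 𝓘(ℝ, ℝ) (fun y => Ycomp ρ (ψ.rep a y) j) x ∧
      ∀ u, mvfderiv (model n) (fun y => Ycomp ρ (ψ.rep a y) j) x u =
        ∑ i, connCoeff D S a x u j i * Ycomp ρ (ψ.rep a x) i -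
          inner ℝ u (S.frame a j x) * ψ.N x +
          ∑ l, k x u (S.frame a l x) * omegaComp ρ (ψ.rep a x) j l := by
  obtain ⟨h1, h2⟩ := mvfderiv_inner_apply Complex.reCLM (Complex.I • clOp ρ j)
    (ψ.mdifferentiableAt_rep hx)
  refine ⟨h1, fun u => (h2 u).trans ?_⟩
  rw [mvfderiv_rep hψ hx, ψ.N_eq hx]
  exact variation_Y ρ (connCoeff_antisymm hD S hx u) _ _ _ j

lemma mvfderiv_omegaComp (hD : IsLeviCivita D) (hψ : IsKilling D k ψ) {a : κ} {x : M}
    (hx : x ∈ S.U a) (i j : Fin n) :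
    MDifferentiableAt (model n) 𝓘(ℝ, ℝ) (fun y => omegaComp ρ (ψ.rep a y) i j) x ∧
      ∀ u, mvfderiv (model n) (fun y => omegaComp ρ (ψ.rep a y) i j) x u =
        ∑ p, connCoeff D S a x u i p * omegaComp ρ (ψ.rep a x) p j +
          ∑ p, connCoeff D S a x u j p * omegaComp ρ (ψ.rep a x) i p +
          (inner ℝ u (S.frame a i x) * Xcomp ρ (ψ.rep a x) j -
            inner ℝ u (S.frame a j x) * Xcomp ρ (ψ.rep a x) i -
            k x u (S.frame a i x) * Ycomp ρ (ψ.rep a x) j +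
            k x u (S.frame a j x) * Ycomp ρ (ψ.rep a x) i) := by
  obtain ⟨h1, h2⟩ := mvfderiv_inner_apply Complex.imCLM (clOp ρ i * (clOp ρ j * clOp₀ Δ))
    (ψ.mdifferentiableAt_rep hx)
  refine ⟨h1, fun u => (h2 u).trans ?_⟩
  rw [mvfderiv_rep hψ hx]
  exact variation_omega ρ (connCoeff_antisymm hD S hx u) _ _ _ i j

lemma covariantDerivative_N (hD : IsLeviCivita D) (hψ : IsKilling D k ψ) (x : M) :
    MDifferentiableAt (model n) 𝓘(ℝ, ℝ) ψ.N x ∧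
      ∀ u, mvfderiv (model n) ψ.N x u = -k x u (ψ.X x) - inner ℝ (ψ.Y x) u := by
  obtain ⟨a, hx⟩ := S.cover x
  obtain ⟨h1, h2⟩ := mvfderiv_N hD hψ hx
  refine ⟨h1, fun u => ?_⟩
  rw [h2, ψ.inner_Y hx, ψ.X_eq hx, map_sum]
  congr 2
  refine Finset.sum_congr rfl fun l _ => ?_
  rw [map_smul, smul_eq_mul, mul_comm]

lemma covariantDerivative_X (hD : IsLeviCivita D) (hψ : IsKilling D k ψ) (x : M) :
    MDifferentiableAt (model n) ((model n).prod 𝓘(ℝ, EuclideanSpace ℝ (Fin n))) (T% ψ.X) x ∧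
      ∀ u v, inner ℝ (D ψ.X x u) v = -k x u v * ψ.N x + ψ.omega x u v := by
  obtain ⟨a, hx⟩ := S.cover x
  obtain ⟨h1, h2⟩ := covariantDerivative_of_components hD hx (fun y hy => ψ.X_eq hy)
    (fun j => (mvfderiv_Xcomp hD hψ hx j).1)
  refine ⟨h1, fun u v => ?_⟩
  rw [h2, ← S.sum_clm_frame hx (k x u) v, ψ.omega_eq hx, Finset.sum_comm, neg_mul,
    Finset.sum_mul, ← Finset.sum_neg_distrib, ← Finset.sum_add_distrib]
  refine Finset.sum_congr rfl fun j _ => ?_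
  -- The connection term of the component derivative cancels here against the one subtracted in the
  -- covariant derivative.
  rw [(mvfderiv_Xcomp hD hψ hx j).2, add_sub_right_comm, sub_sub_cancel_left, mul_add,
    Finset.mul_sum]
  congr 1
  · ring
  · refine Finset.sum_congr rfl fun l _ => ?_
    rw [real_inner_comm u, real_inner_comm v]
    ring

lemma covariantDerivative_Y (hD : IsLeviCivita D) (hψ : IsKilling D k ψ) (x : M) :
    MDifferentiableAt (model n) ((model n).prod 𝓘(ℝ, EuclideanSpace ℝ (Fin n))) (T% ψ.Y) x ∧
      ∀ u v, ∀ e : OrthonormalBasis (Fin n) ℝ (TangentSpace (model n) x),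
        inner ℝ (D ψ.Y x u) v =
          -inner ℝ u v * ψ.N x + ∑ l, k x u (e l) * ψ.omega x v (e l) := by
  obtain ⟨a, hx⟩ := S.cover x
  obtain ⟨h1, h2⟩ := covariantDerivative_of_components hD hx (fun y hy => ψ.Y_eq hy)
    (fun j => (mvfderiv_Ycomp hD hψ hx j).1)
  refine ⟨h1, fun u v e => ?_⟩
  rw [h2, ψ.sum_clm_mul_omega hx (k x u) v e, ← S.sum_inner_mul_inner hx u v, neg_mul,
    Finset.sum_mul, ← Finset.sum_neg_distrib, ← Finset.sum_add_distrib]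
  refine Finset.sum_congr rfl fun j _ => ?_
  rw [(mvfderiv_Ycomp hD hψ hx j).2]
  ring

lemma covDeriv₂_omega (hD : IsLeviCivita D) (hψ : IsKilling D k ψ) (x : M)
    {V W : (y : M) → TangentSpace (model n) y}
    (hV : MDifferentiableAt (model n)
      ((model n).prod 𝓘(ℝ, EuclideanSpace ℝ (Fin n))) (T% V) x)
    (hW : MDifferentiableAt (model n)
      ((model n).prod 𝓘(ℝ, EuclideanSpace ℝ (Fin n))) (T% W) x) :
    MDifferentiableAt (model n) 𝓘(ℝ, ℝ) (fun y => ψ.omega y (V y) (W y)) x ∧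
      ∀ u, covDeriv₂ D ψ.omega V W x u =
        inner ℝ u (V x) * inner ℝ (ψ.X x) (W x) - inner ℝ u (W x) * inner ℝ (ψ.X x) (V x)
          - k x u (V x) * inner ℝ (ψ.Y x) (W x) + k x u (W x) * inner ℝ (ψ.Y x) (V x) := by
  obtain ⟨a, hx⟩ := S.cover x
  have hev : (fun y => ψ.omega y (V y) (W y)) =ᶠ[nhds x] fun y => ∑ i, ∑ j,
      omegaComp ρ (ψ.rep a y) i j * inner ℝ (S.frame a i y) (V y) *
        inner ℝ (S.frame a j y) (W y) := by
    filter_upwards [(S.isOpen a).mem_nhds hx] with y hy using ψ.omega_eq hy _ _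
  have hVi : ∀ i, MDifferentiableAt (model n) 𝓘(ℝ, ℝ)
      (fun y => inner ℝ (S.frame a i y) (V y)) x :=
    fun i => (S.mdifferentiableAt_frame hx i).inner_bundle hV
  have hWi : ∀ i, MDifferentiableAt (model n) 𝓘(ℝ, ℝ)
      (fun y => inner ℝ (S.frame a i y) (W y)) x :=
    fun i => (S.mdifferentiableAt_frame hx i).inner_bundle hW
  have ho := fun i j => (mvfderiv_omegaComp hD hψ hx i j).1
  have hterm := fun i j => mvfderiv_mul_mul (ho i j) (hVi i) (hWi j)
  have hrow := fun i => mvfderiv_finset_sum Finset.univ fun j _ => (hterm i j).1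
  have hall := mvfderiv_finset_sum Finset.univ fun i _ => (hrow i).1
  refine ⟨hall.1.congr_of_eventuallyEq hev, fun u => ?_⟩
  -- The frame components of a field `Z` differentiate to a rotation of themselves plus the
  -- components of `D_u Z`, the shape required by `sum_two_form_derivative`.
  have hmetric : ∀ {Z : (y : M) → TangentSpace (model n) y}, MDifferentiableAt (model n)
      ((model n).prod 𝓘(ℝ, EuclideanSpace ℝ (Fin n))) (T% Z) x → ∀ i,
      mvfderiv (model n) (fun y => (inner ℝ (S.frame a i y) (Z y) : ℝ)) x u =
        ∑ p, connCoeff D S a x u i p * inner ℝ (S.frame a p x) (Z x) +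
          inner ℝ (S.frame a i x) (D Z x u) := by
    intro Z hZ i
    have h := hD.metric.mvfderiv_inner_eq (x := x)
      (FiberBundle.extend (EuclideanSpace ℝ (Fin n)) u) (S.mdifferentiableAt_frame hx i) hZ
    simp only [FiberBundle.extend_apply_self] at h
    rw [h, ← S.sum_inner_mul_inner hx (D (S.frame a i) x u) (Z x)]
    congr 1
    exact Finset.sum_congr rfl fun p _ => by rw [real_inner_comm (Z x)]; rfl
  have hsum := hall.2 u
  simp only [fun i => (hrow i).2 u, fun i j => (hterm i j).2 u, hmetric hV, hmetric hW,
    fun i j => (mvfderiv_omegaComp hD hψ hx i j).2 u] at hsum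
  rw [sum_two_form_derivative (connCoeff_antisymm hD S hx u), sum_wedge] at hsum
  have hinner : ∀ Z : TangentSpace (model n) x,
      ∑ i, inner ℝ u (S.frame a i x) * inner ℝ (S.frame a i x) Z = (inner ℝ u Z : ℝ) :=
    fun Z => by
      rw [← S.sum_inner_mul_inner hx u Z]
      simp only [real_inner_comm Z]
  have hk' : ∀ Z : TangentSpace (model n) x,
      ∑ i, inner ℝ (S.frame a i x) Z * k x u (S.frame a i x) = k x u Z := fun Z => by
    rw [← S.sum_clm_frame hx (k x u) Z]
    simp only [real_inner_comm Z]
  have hX' : ∀ Z : TangentSpace (model n) x,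
      ∑ i, inner ℝ (S.frame a i x) Z * Xcomp ρ (ψ.rep a x) i = (inner ℝ (ψ.X x) Z : ℝ) :=
    fun Z => by
      rw [ψ.inner_X hx]
      simp only [real_inner_comm Z]
  have hY' : ∀ Z : TangentSpace (model n) x,
      ∑ i, inner ℝ (S.frame a i x) Z * Ycomp ρ (ψ.rep a x) i = (inner ℝ (ψ.Y x) Z : ℝ) :=
    fun Z => by
      rw [ψ.inner_Y hx]
      simp only [real_inner_comm Z]
  rw [hinner, hinner, hk', hk', hX', hX', hY', hY'] at hsum
  -- The remaining `ω(D_u V, W)` and `ω(V, D_u W)` are exactly what `covDeriv₂` subtracts.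
  rw [covDeriv₂, mvfderiv_congr hev, hsum, ψ.omega_eq hx, ψ.omega_eq hx]
  ring

lemma mvfderiv_localInvariant (hD : IsLeviCivita D) (hψ : IsKilling D k ψ) {a : κ} {x : M}
    (hx : x ∈ S.U a) :
    MDifferentiableAt (model n) 𝓘(ℝ, ℝ) (ψ.localInvariant a) x ∧
      ∀ u, mvfderiv (model n) (ψ.localInvariant a) x u = 0 := by
  have hN := mvfderiv_N hD hψ hx
  have hX := mvfderiv_Xcomp hD hψ hx
  have hY := mvfderiv_Ycomp hD hψ hx
  have hω := mvfderiv_omegaComp hD hψ hx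
  have dN := mvfderiv_sq hN.1
  have dX := mvfderiv_finset_sum Finset.univ fun j _ => (mvfderiv_sq (hX j).1).1
  have dY := mvfderiv_finset_sum Finset.univ fun j _ => (mvfderiv_sq (hY j).1).1
  have dr := fun i => mvfderiv_finset_sum Finset.univ fun j _ => (mvfderiv_sq (hω i j).1).1
  have dω := mvfderiv_finset_sum Finset.univ fun i _ => (dr i).1
  have d1 := dN.1.sub dX.1
  have d2 := d1.sub dY.1
  have d3 := dω.1.const_smul (1 / 2 : ℝ)
  refine ⟨d2.add d3, fun u => ?_⟩
  have h : mvfderiv (model n) (ψ.localInvariant a) x u =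
      mvfderiv (model n) (fun y => ψ.N y ^ 2) x u -
        mvfderiv (model n) (fun y => ∑ j, Xcomp ρ (ψ.rep a y) j ^ 2) x u -
        mvfderiv (model n) (fun y => ∑ j, Ycomp ρ (ψ.rep a y) j ^ 2) x u +
        1 / 2 * mvfderiv (model n) (fun y => ∑ i, ∑ j, omegaComp ρ (ψ.rep a y) i j ^ 2) x u := by
    refine (congrArg (fun L => L u) (mvfderiv_add d2 d3)).trans ?_
    rw [add_apply, mvfderiv_sub d1 dY.1, sub_apply, mvfderiv_sub dN.1 dX.1, sub_apply]
    congr 1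
    refine (congrArg (fun L => L u) (mvfderiv_smul (mdifferentiableAt_const (c := (1 / 2 : ℝ)))
      dω.1)).trans ?_
    simp [mvfderiv_const]
  rw [h, dN.2, dX.2, dY.2, dω.2, hN.2]
  simp only [fun i => (dr i).2 u, fun j => (mvfderiv_sq (hX j).1).2 u,
    fun j => (mvfderiv_sq (hY j).1).2 u, fun i j => (mvfderiv_sq (hω i j).1).2 u,
    fun j => (hX j).2 u, fun j => (hY j).2 u, fun i j => (hω i j).2 u]
  exact conserved_identity (connCoeff_antisymm hD S hx u) (omegaComp_antisymm ρ _) _ _ _ _ _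

/-- The function `N² - |X|² - |Y|² + ½|ω|²` is constant. -/
lemma exists_invariant_eq_const [ConnectedSpace M] (hD : IsLeviCivita D) (hψ : IsKilling D k ψ) :
    ∃ c : ℝ, ∀ x : M, ∀ e : OrthonormalBasis (Fin n) ℝ (TangentSpace (model n) x),
      ψ.N x ^ 2 - ‖ψ.X x‖ ^ 2 - ‖ψ.Y x‖ ^ 2 +
        1 / 2 * ∑ i, ∑ j, ψ.omega x (e i) (e j) ^ 2 = c := by
  have hU : ∀ x, x ∈ S.U (S.indexAt x) := fun x => (S.cover x).choose_spec
  -- Both local expressions equal the same frame-free quantity at `y`, evaluated in any orthonormal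
  -- basis there, so the index may be frozen near `x` before differentiating.
  have hev : ∀ x, (fun y => ψ.localInvariant (S.indexAt y) y) =ᶠ[nhds x]
      ψ.localInvariant (S.indexAt x) := by
    intro x
    filter_upwards [(S.isOpen _).mem_nhds (hU x)] with y hy
    obtain ⟨e⟩ := S.exists_orthonormalBasis y
    rw [← ψ.localInvariant_eq (hU y) e, ψ.localInvariant_eq hy e]
  have : IsManifold (model n) 1 M := IsManifold.of_le (n := ∞) (by simp)
  obtain ⟨c, hc⟩ := exists_const_of_mvfderiv_eq_zero (I := model n)
    (f := fun y => ψ.localInvariant (S.indexAt y) y)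
    (fun x => (mvfderiv_localInvariant hD hψ (hU x)).1.congr_of_eventuallyEq (hev x))
    (fun x u => by rw [mvfderiv_congr (hev x), (mvfderiv_localInvariant hD hψ (hU x)).2])
  exact ⟨c, fun x e => (ψ.localInvariant_eq (hU x) e).trans (hc x)⟩

end SpinorField

end System

end KillingBilinears

end

theorem mainTheorem10 {n : ℕ} {M : Type*} [TopologicalSpace M]
    [ChartedSpace (EuclideanSpace ℝ (Fin n)) M]
    [IsManifold (KillingBilinears.model n) ∞ M] [ConnectedSpace M]
    [RiemannianBundle (fun x : M => TangentSpace (KillingBilinears.model n) x)]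
    [IsContMDiffRiemannianBundle (KillingBilinears.model n) 1 (EuclideanSpace ℝ (Fin n))
      (fun x : M => TangentSpace (KillingBilinears.model n) x)]
    (D : CovariantDerivative (KillingBilinears.model n) (EuclideanSpace ℝ (Fin n))
      (fun x : M => TangentSpace (KillingBilinears.model n) x))
    (hD : KillingBilinears.IsLeviCivita D)
    (k : (x : M) → TangentSpace (KillingBilinears.model n) x →L[ℝ]
      TangentSpace (KillingBilinears.model n) x →L[ℝ] ℝ)
    (hk : ∀ x u v, k x u v = k x v u)
    {κ : Type*} (S : KillingBilinears.SpinStructure n M κ)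
    {Δ : Type*} [NormedAddCommGroup Δ] [InnerProductSpace ℂ Δ] [FiniteDimensional ℂ Δ]
    (ρ : KillingBilinears.SpinorModule n Δ)
    (ψ : KillingBilinears.SpinorField S ρ) (hψ : KillingBilinears.IsKilling D k ψ) :
    -- `N`, `X`, `Y`, `ω` are differentiable and satisfy the first-order system
    (∀ x : M,
      (MDifferentiableAt (KillingBilinears.model n) 𝓘(ℝ, ℝ) ψ.N x ∧
        ∀ u, mvfderiv (KillingBilinears.model n) ψ.N x u =
          -k x u (ψ.X x) - inner ℝ (ψ.Y x) u) ∧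
      (MDifferentiableAt (KillingBilinears.model n)
        ((KillingBilinears.model n).prod 𝓘(ℝ, EuclideanSpace ℝ (Fin n))) (T% ψ.X) x ∧
        ∀ u v, inner ℝ (D ψ.X x u) v = -k x u v * ψ.N x + ψ.omega x u v) ∧
      (MDifferentiableAt (KillingBilinears.model n)
        ((KillingBilinears.model n).prod 𝓘(ℝ, EuclideanSpace ℝ (Fin n))) (T% ψ.Y) x ∧
        ∀ u v, ∀ e : OrthonormalBasis (Fin n) ℝ (TangentSpace (KillingBilinears.model n) x),
          inner ℝ (D ψ.Y x u) v =
            -inner ℝ u v * ψ.N x + ∑ l, k x u (e l) * ψ.omega x v (e l)) ∧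
      (∀ V W : (y : M) → TangentSpace (KillingBilinears.model n) y,
        MDifferentiableAt (KillingBilinears.model n)
        ((KillingBilinears.model n).prod 𝓘(ℝ, EuclideanSpace ℝ (Fin n))) (T% V) x → MDifferentiableAt (KillingBilinears.model n)
        ((KillingBilinears.model n).prod 𝓘(ℝ, EuclideanSpace ℝ (Fin n))) (T% W) x →
        MDifferentiableAt (KillingBilinears.model n) 𝓘(ℝ, ℝ)
          (fun y => ψ.omega y (V y) (W y)) x ∧
        ∀ u, KillingBilinears.covDeriv₂ D ψ.omega V W x u =
          inner ℝ u (V x) * inner ℝ (ψ.X x) (W x) - inner ℝ u (W x) * inner ℝ (ψ.X x) (V x)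
            - k x u (V x) * inner ℝ (ψ.Y x) (W x) + k x u (W x) * inner ℝ (ψ.Y x) (V x))) ∧
    -- the quantity `N² - |X|² - |Y|² + ½ |ω|²` is constant
    (∃ c : ℝ, ∀ x : M,
      ∀ e : OrthonormalBasis (Fin n) ℝ (TangentSpace (KillingBilinears.model n) x),
        ψ.N x ^ 2 - ‖ψ.X x‖ ^ 2 - ‖ψ.Y x‖ ^ 2
          + 1 / 2 * ∑ i, ∑ j, ψ.omega x (e i) (e j) ^ 2 = c) := by
  refine ⟨fun x => ⟨KillingBilinears.SpinorField.covariantDerivative_N hD hψ x,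
    KillingBilinears.SpinorField.covariantDerivative_X hD hψ x,
    KillingBilinears.SpinorField.covariantDerivative_Y hD hψ x,
    fun V W hV hW => KillingBilinears.SpinorField.covDeriv₂_omega hD hψ x hV hW⟩,
    KillingBilinears.SpinorField.exists_invariant_eq_const hD hψ⟩
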